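/- All simplicial complexes are finite abstract simplicial complexes, with the empty set counted as a face, and $\dim\alpha=\#\alpha-1$ for a finite set $\alpha$. For a finite set $\alpha$ let $\overline{\alpha}$ (respectively $\partial\alpha$) be the complex of all subsets (respectively all proper subsets) of $\alpha$, and let $X\ast Y$ be the join, whose faces are the disjoint unions of a face of $X$ with a face of $Y$. The standard $d$-sphere is $\partial\alpha$ with $\#\alpha=d+2$. Let $X$ be a complex of dimension $d$ and let $\alpha,\beta$ be disjoint nonempty finite sets with $\dim\alpha+\dim\beta=d$ such that the faces of $X$ contained in $\alpha\sqcup\beta$ are exactly the faces of $\overline{\alpha}\ast\partial\beta$. Then the complex $(X\setminus(\overline{\alpha}\ast\partial\beta))\cup(\partial\alpha\ast\overline{\beta})$ is said to be obtained from $X$ by the bistellar move $\alpha\mapsto\beta$, of index $\dim\beta$. (In a move of index $0$, $\beta$ is a new vertex.) For $0\le k\le d+1$, a complex is $k$-stellated (of dimension $d$) if it can be obtained, up to isomorphism, from the standard $d$-sphere by a finite (possibly empty) sequence of bistellar moves, each of index less than $k$. A complex is $l$-neighbourly if any $l$ of its vertices form a face. A polytopal $d$-sphere is a simplicial complex isomorphic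 to the boundary complex of a $(d+1)$-dimensional simplicial polytope. Theorem 5. Let $0\le k\le d$ be integers and let $S$ be a $(k+1)$-neighbourly polytopal $d$-sphere. Then $S$ is $(d-k)$-stellated. In particular, every polytopal $d$-sphere is $d$-stellated. -/

import Mathlib

/-! Abstract simplicial complexes are Mathlib's `PreAbstractSimplicialComplex`: downward closed
families of nonempty finite sets of points of an ambient type. The vertices of a complex are the
points whose singletons are faces (the ambient type may contain further points). The empty set,
which is by convention also a face of every complex, is added by `IsFace`. -/

namespace PreAbstractSimplicialComplex

/-- Faces in the convention where the empty set is a face of every simplicial complex. -/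
def IsFace {V : Type*} (X : PreAbstractSimplicialComplex V) (s : Finset V) : Prop :=
  s = ∅ ∨ s ∈ X

theorem IsFace.mono {V : Type*} {X : PreAbstractSimplicialComplex V} {s t : Finset V}
    (hs : X.IsFace s) (hts : t ⊆ s) : X.IsFace t := by
  rcases t.eq_empty_or_nonempty with rfl | ht
  · exact Or.inl rfl
  · rcases hs with rfl | hs
    · exact Or.inl (Finset.subset_empty.mp hts)
    · exact Or.inr ((X.isRelLowerSet_faces hs).2 hts ht)

/-- The vertex set of a complex. -/
def vertices {V : Type*} (X : PreAbstractSimplicialComplex V) : Set V :=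
  {v | {v} ∈ X}

/-- `X` has dimension `d`: the largest faces have `d + 1` vertices. -/
def HasDim {V : Type*} (X : PreAbstractSimplicialComplex V) (d : ℕ) : Prop :=
  (∃ s ∈ X, s.card = d + 1) ∧ ∀ s ∈ X, s.card ≤ d + 1

/-- Isomorphism of complexes: a bijection between the vertex sets that identifies the faces. -/
def IsIsomorphic {V W : Type*} (X : PreAbstractSimplicialComplex V)
    (Y : PreAbstractSimplicialComplex W) : Prop :=
  ∃ e : X.vertices ≃ Y.vertices, ∀ s : Finset X.vertices,
    s.map (Function.Embedding.subtype _) ∈ X ↔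
      (s.map e.toEmbedding).map (Function.Embedding.subtype _) ∈ Y

/-- `X` is `l`-neighbourly: any `l` vertices of `X` form a face of `X`. -/
def IsNeighbourly {V : Type*} (X : PreAbstractSimplicialComplex V) (l : ℕ) : Prop :=
  ∀ s : Finset V, (s : Set V) ⊆ X.vertices → s.card = l → X.IsFace s

/-- The complex of all subsets of a finite set `α` (a simplex with vertex set `α`). -/
def simplex {V : Type*} (α : Finset V) : PreAbstractSimplicialComplex V where
  faces := {s | s.Nonempty ∧ s ⊆ α}
  isRelLowerSet_faces := fun _ hs => ⟨hs.1, fun _ hts ht => ⟨ht, hts.trans hs.2⟩⟩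

/-- The complex of all proper subsets of a finite set `α`. If `α` has `d + 2` elements, this is
the standard `d`-sphere with vertex set `α`. -/
def simplexBoundary {V : Type*} (α : Finset V) : PreAbstractSimplicialComplex V where
  faces := {s | s.Nonempty ∧ s ⊂ α}
  isRelLowerSet_faces := fun _ hs => ⟨hs.1, fun _ hts ht => ⟨ht, lt_of_le_of_lt hts hs.2⟩⟩

/-- The join of two complexes: its faces are the disjoint unions of a (possibly empty) face of `X`
with a (possibly empty) face of `Y`. -/
def join {V : Type*} [DecidableEq V] (X Y : PreAbstractSimplicialComplex V) :
    PreAbstractSimplicialComplex V where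
  faces := {s | s.Nonempty ∧ ∃ σ τ : Finset V,
    X.IsFace σ ∧ Y.IsFace τ ∧ Disjoint σ τ ∧ s = σ ∪ τ}
  isRelLowerSet_faces := by
    rintro s ⟨hs, σ, τ, hσ, hτ, hd, rfl⟩
    refine ⟨hs, fun t hts ht => ⟨ht, σ ∩ t, τ ∩ t, hσ.mono Finset.inter_subset_left,
      hτ.mono Finset.inter_subset_left,
      hd.mono Finset.inter_subset_left Finset.inter_subset_left, ?_⟩⟩
    rw [← Finset.union_inter_distrib_right]
    exact (Finset.inter_eq_right.mpr hts).symm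

/-- The subcomplex of `X` induced on a set `U`: all faces of `X` contained in `U`. -/
def induced {V : Type*} (X : PreAbstractSimplicialComplex V) (U : Set V) :
    PreAbstractSimplicialComplex V where
  faces := {s | s ∈ X ∧ (s : Set V) ⊆ U}
  isRelLowerSet_faces := fun _ hs => ⟨(X.isRelLowerSet_faces hs.1).1, fun _ hts ht =>
    ⟨(X.isRelLowerSet_faces hs.1).2 hts ht, (Finset.coe_subset.mpr hts).trans hs.2⟩⟩

/-- `Y` is obtained from the `d`-dimensional complex `X` by the bistellar move `α ↦ β`:
`α` and `β` are disjoint nonempty finite sets with `dim α + dim β = d`, the subcomplex of `X`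
induced on `α ∪ β` is the join of the simplex `α` with the boundary of the simplex `β`, and `Y`
arises from `X` by replacing it with the join of the boundary of `α` with the simplex `β`. -/
def IsBistellarMove {V : Type*} [DecidableEq V] (d : ℕ) (X Y : PreAbstractSimplicialComplex V)
    (α β : Finset V) : Prop :=
  X.HasDim d ∧ α.Nonempty ∧ β.Nonempty ∧ Disjoint α β ∧ α.card + β.card = d + 2 ∧
  X.induced (α ∪ β : Finset V) = (simplex α).join (simplexBoundary β) ∧
  Y.faces = (X.faces \ ((simplex α).join (simplexBoundary β)).faces) ∪
    ((simplexBoundary α).join (simplex β)).faces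

/-- `Y` is obtained from the `d`-dimensional complex `X` by a bistellar move of index `i`, i.e. by
a bistellar move `α ↦ β` with `dim β = i`. -/
def IsBistellarMoveOfIndex {V : Type*} [DecidableEq V] (d i : ℕ)
    (X Y : PreAbstractSimplicialComplex V) : Prop :=
  ∃ α β : Finset V, β.card = i + 1 ∧ IsBistellarMove d X Y α β

/-- A `d`-dimensional complex is `k`-stellated if it can be obtained, up to isomorphism, from the
standard `d`-sphere by a finite sequence of bistellar moves, each of index less than `k`. The
sequence lives on vertices from the infinite set `ℕ`, so new vertices are always available. -/
def IsStellated {V : Type*} (X : PreAbstractSimplicialComplex V) (d k : ℕ) : Prop :=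
  ∃ (α : Finset ℕ) (Y : PreAbstractSimplicialComplex ℕ), α.card = d + 2 ∧
    Relation.ReflTransGen (fun A B : PreAbstractSimplicialComplex ℕ =>
      ∃ i < k, IsBistellarMoveOfIndex d i A B) (simplexBoundary α) Y ∧
    X.IsIsomorphic Y

end PreAbstractSimplicialComplex

/-- `F` is a proper face of `P`: a face cut out by a supporting hyperplane (or empty), other than
`P` itself. -/
def IsProperFace {n : ℕ} (P F : Set (EuclideanSpace ℝ (Fin n))) : Prop :=
  IsExposed ℝ P F ∧ F ≠ P

/-- `P` is a `D`-dimensional simplicial polytope in `ℝⁿ`: the convex hull of a finite set, with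
affine hull of dimension `D`, all of whose proper faces are simplices. -/
def IsSimplicialPolytope {n : ℕ} (D : ℕ) (P : Set (EuclideanSpace ℝ (Fin n))) : Prop :=
  (∃ t : Finset (EuclideanSpace ℝ (Fin n)), P = convexHull ℝ (t : Set _)) ∧
  P.Nonempty ∧ Module.finrank ℝ (vectorSpan ℝ P) = D ∧
  ∀ F, IsProperFace P F → ∃ t : Finset (EuclideanSpace ℝ (Fin n)),
    AffineIndependent ℝ ((↑) : t → EuclideanSpace ℝ (Fin n)) ∧ F = convexHull ℝ (t : Set _)

/-- The boundary complex of a simplicial polytope `P`, as an abstract complex on the vertices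
(extreme points) of `P`: its faces are the nonempty sets of vertices of `P` that lie in a common
proper face of `P`. As the proper faces of `P` are simplices, and faces of such a simplex are again
faces of `P`, these are exactly the vertex sets of the nonempty proper faces of `P`. -/
def polytopeBoundaryComplex {n : ℕ} (P : Set (EuclideanSpace ℝ (Fin n))) :
    PreAbstractSimplicialComplex (EuclideanSpace ℝ (Fin n)) where
  faces := {s | s.Nonempty ∧ (s : Set _) ⊆ P.extremePoints ℝ ∧
    ∃ F, IsProperFace P F ∧ (s : Set _) ⊆ F}
  isRelLowerSet_faces := by
    rintro s ⟨hs, hsP, F, hF, hsF⟩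
    exact ⟨hs, fun t hts ht => ⟨ht, (Finset.coe_subset.mpr hts).trans hsP, F, hF,
      (Finset.coe_subset.mpr hts).trans hsF⟩⟩

/-- `S` is a polytopal `d`-sphere: it is isomorphic to the boundary complex of a
`(d + 1)`-dimensional simplicial polytope. -/
def PreAbstractSimplicialComplex.IsPolytopalSphere {V : Type*}
    (S : PreAbstractSimplicialComplex V) (d : ℕ) : Prop :=
  ∃ (n : ℕ) (P : Set (EuclideanSpace ℝ (Fin n))), IsSimplicialPolytope (d + 1) P ∧
    S.IsIsomorphic (polytopeBoundaryComplex P)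

/-! Put a generic origin inside the polytope and let `v i` be its vertices. The boundary complex
records which inequalities `a (v i) ≤ 1` of the polar polytope can be tight together. For generic
`h` the polyhedron of pairs `(a, t)` with `a (v i) ≤ h i + t` is simple, and `sweep` slices it by
level `t`. Low levels are empty. High levels, rescaled, are small perturbations of the polar
polytope, so they carry the given complex because the polytope is simplicial
(`eventually_mem_sweep_inv_iff`).

The complex changes only at levels of vertices of the polyhedron. At such a vertex a set `T` of `d +
2` inequalities is tight, and the origin is an affine combination of the corresponding `v i` with
nonzero coefficients `l`. The `l`-weighted slack equals the height above the vertex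
(`sum_mul_slack`), so the signs of `l` decide which subsets of `T` are faces just below and just
above. Crossing is thus the bistellar move from `{l > 0}` to `{l < 0}` (`isBistellarMove`) or, when
no coefficient is negative, the birth of a standard sphere (`sweep_eq_simplexBoundary`).

The index bound is convexity: the levels at which a set is a face form an interval
(`mem_sweep_of_mem_of_mem`). The set `α = {l > 0}` is a face at the critical level but not right
above it, hence not at the end. Neighbourliness makes all sets of at most `k + 1` vertices final
faces, so `α` has at least `k + 2` elements and `β = {l < 0}` at most `d - k`. -/

open Filter Topology

namespace PreAbstractSimplicialComplex

/-! ### Polar polyhedra and their level sets -/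

section Polar

variable {ι E : Type*} [NormedAddCommGroup E] [NormedSpace ℝ E]

/-- The boundary complex of the dual of the polyhedron `{a | a (v i) ≤ c i for i ∈ I}`: its faces
are the nonempty sets of inequalities that can be simultaneously tight. -/
def polarComplex (I : Finset ι) (v : ι → E) (c : ι → ℝ) : PreAbstractSimplicialComplex ι where
  faces := {s | s.Nonempty ∧ s ⊆ I ∧
    ∃ a : E →L[ℝ] ℝ, (∀ i ∈ I, a (v i) ≤ c i) ∧ ∀ i ∈ s, a (v i) = c i}
  isRelLowerSet_faces := fun _ hs => ⟨hs.1, fun _ hts ht => ⟨ht, hts.trans hs.2.1,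
    hs.2.2.imp fun _ ha => ⟨ha.1, fun i hi => ha.2 i (hts hi)⟩⟩⟩

/-- The origin lies in the interior of the convex hull of the `v i`: no functional is small on all
of them. -/
def SurroundsOrigin (I : Finset ι) (v : ι → E) : Prop :=
  ∃ r > 0, ∀ a : E →L[ℝ] ℝ, ∃ i ∈ I, r * ‖a‖ ≤ a (v i)

/-- Compactness: since the origin is surrounded, `r * ‖a‖` is at most some right-hand side, so
witnesses along a convergent sequence of parameters are bounded and subconverge; the defining
conditions are closed. -/
theorem isClosed_setOf_mem_polarComplex [FiniteDimensional ℝ E] {I : Finset ι} {v : ι → E}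
    (hv : SurroundsOrigin I v) {c : ℝ → ι → ℝ} (hc : ∀ i, Continuous fun t => c t i)
    (s : Finset ι) : IsClosed {t | s ∈ polarComplex I v (c t)} := by
  obtain ⟨r, hr, hrv⟩ := hv
  refine IsSeqClosed.isClosed fun t t₀ ht htt => ?_
  choose hs hsI a ha has using ht
  have hprop : ProperSpace (E →L[ℝ] ℝ) := FiniteDimensional.proper ℝ _
  have hcont : Continuous fun t => ∑ i ∈ I, |c t i| :=
    continuous_finsetSum _ fun i _ => (hc i).abs
  obtain ⟨M, hM⟩ := ((hcont.tendsto t₀).comp htt).isBoundedUnder_le.eventually_le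
  obtain ⟨N, hN⟩ := eventually_atTop.mp hM
  have hbound : ∀ n, a (n + N) ∈ Metric.closedBall (0 : E →L[ℝ] ℝ) (M / r) := fun n => by
    rw [mem_closedBall_zero_iff, le_div_iff₀ hr, mul_comm]
    obtain ⟨i, hi, hia⟩ := hrv (a (n + N))
    calc r * ‖a (n + N)‖ ≤ a (n + N) (v i) := hia
      _ ≤ c (t (n + N)) i := ha _ i hi
      _ ≤ |c (t (n + N)) i| := le_abs_self _
      _ ≤ ∑ i ∈ I, |c (t (n + N)) i| :=
        Finset.single_le_sum (f := fun i => |c (t (n + N)) i|) (fun _ _ => abs_nonneg _) hi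
      _ ≤ M := hN _ (Nat.le_add_left _ _)
  obtain ⟨a₀, -, φ, hφ, hlim⟩ := tendsto_subseq_of_bounded Metric.isBounded_closedBall hbound
  have htφ : Tendsto (fun n => t (φ n + N)) atTop (𝓝 t₀) :=
    htt.comp ((tendsto_add_atTop_nat N).comp hφ.tendsto_atTop)
  have hca : ∀ i, Tendsto (fun n => c (t (φ n + N)) i) atTop (𝓝 (c t₀ i)) := fun i =>
    ((hc i).tendsto t₀).comp htφ
  have haa : ∀ i, Tendsto (fun n => a (φ n + N) (v i)) atTop (𝓝 (a₀ (v i))) := fun i =>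
    ((ContinuousLinearMap.apply ℝ ℝ (v i)).continuous.tendsto a₀).comp hlim
  exact ⟨hs 0, hsI 0, a₀, fun i hi => le_of_tendsto_of_tendsto' (haa i) (hca i) fun n => ha _ i hi,
    fun i hi => tendsto_nhds_unique (haa i) ((hca i).congr fun n => (has _ i hi).symm)⟩

theorem exists_apply_eq [FiniteDimensional ℝ E] {v : ι → E} {s : Finset ι}
    (hs : LinearIndependent ℝ fun i : s => v i) (g : ι → ℝ) :
    ∃ w : E →L[ℝ] ℝ, ∀ i ∈ s, w (v i) = g i := by
  obtain ⟨f, hf⟩ := LinearMap.exists_extend ((Module.Basis.span hs).constr ℝ fun i : s => g i)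
  refine ⟨LinearMap.toContinuousLinearMap f, fun i hi => ?_⟩
  have h1 := LinearMap.congr_fun hf (Module.Basis.span hs ⟨i, hi⟩)
  rw [Module.Basis.constr_basis, LinearMap.comp_apply, Submodule.subtype_apply,
    Module.Basis.span_apply] at h1
  exact h1

/-- A face persists when the right-hand sides move in the direction `g`, if there is a direction `w`
for the functional that respects all tight inequalities. -/
theorem eventually_mem_polarComplex {I : Finset ι} {v : ι → E} {c g : ι → ℝ} {s : Finset ι}
    (hs : s.Nonempty) (hsI : s ⊆ I) {a w : E →L[ℝ] ℝ} (ha : ∀ i ∈ I, a (v i) ≤ c i)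
    (has : ∀ i ∈ s, a (v i) = c i) (hws : ∀ i ∈ s, w (v i) = g i) {l : Filter ℝ} (hl : l ≤ 𝓝 0)
    (hw : ∀ i ∈ I, a (v i) = c i → ∀ᶠ x in l, x * w (v i) ≤ x * g i) :
    ∀ᶠ x in l, s ∈ polarComplex I v fun i => c i + x * g i := by
  have key : ∀ i ∈ I, ∀ᶠ x in l, (a + x • w) (v i) ≤ c i + x * g i := by
    intro i hi
    rcases (ha i hi).eq_or_lt with h | h
    · filter_upwards [hw i hi h] with x hx
      simpa [h] using hx
    · have h1 : Continuous fun x : ℝ => a (v i) + x * w (v i) := by fun_prop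
      have h2 : Continuous fun x : ℝ => c i + x * g i := by fun_prop
      filter_upwards [hl ((h1.tendsto 0).eventually_lt (h2.tendsto 0) (by simpa using h))] with x hx
      simpa using hx.le
  filter_upwards [(Filter.eventually_all_finset I).mpr key] with x hx
  exact ⟨hs, hsI, a + x • w, hx, fun i hi => by simp [has i hi, hws i hi]⟩

/-- The set `T` of inequalities `a (v i) ≤ h i + t` can be made tight simultaneously. -/
def IsTightAt (v : ι → E) (h : ι → ℝ) (t : ℝ) (T : Finset ι) : Prop :=
  ∃ a : E →L[ℝ] ℝ, ∀ i ∈ T, a (v i) = h i + t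

/-- The polyhedron `{(a, t) | a (v i) ≤ h i + t}` is simple, `t` is a generic linear function on
it, and its sublevel sets are bounded. -/
structure IsGenericSweep (I : Finset ι) (v : ι → E) (h : ι → ℝ) : Prop where
  surroundsOrigin : SurroundsOrigin I v
  linearIndependent : ∀ t, ∀ T ⊆ I, IsTightAt v h t T → T.card ≤ Module.finrank ℝ E →
    LinearIndependent ℝ fun i : T => v i
  circuit : ∀ t, ∀ T ⊆ I, IsTightAt v h t T → Module.finrank ℝ E < T.card →
    T.card = Module.finrank ℝ E + 1 ∧
      ∃ l : ι → ℝ, ∑ i ∈ T, l i = 1 ∧ ∑ i ∈ T, l i • v i = 0 ∧ ∀ i ∈ T, l i ≠ 0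
  unique : ∀ t, ∀ T ⊆ I, ∀ T' ⊆ I, IsTightAt v h t T → IsTightAt v h t T' →
    T.card = Module.finrank ℝ E + 1 → T'.card = Module.finrank ℝ E + 1 → T = T'

/-- The boundary complexes of the levels of a simple polyhedron. -/
def sweep (I : Finset ι) (v : ι → E) (h : ι → ℝ) (t : ℝ) : PreAbstractSimplicialComplex ι :=
  polarComplex I v fun i => h i + t

theorem mem_sweep {I : Finset ι} {v : ι → E} {h : ι → ℝ} {t : ℝ} {s : Finset ι} :
    s ∈ sweep I v h t ↔ s.Nonempty ∧ s ⊆ I ∧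
      ∃ a : E →L[ℝ] ℝ, (∀ i ∈ I, a (v i) ≤ h i + t) ∧ ∀ i ∈ s, a (v i) = h i + t :=
  Iff.rfl

/-- Convex combinations of the two witnesses are witnesses at the intermediate levels. -/
theorem mem_sweep_of_mem_of_mem {I : Finset ι} {v : ι → E} {h : ι → ℝ} {t₁ t₂ t : ℝ}
    {s : Finset ι} (h₁ : s ∈ sweep I v h t₁) (h₂ : s ∈ sweep I v h t₂) (ht₁ : t₁ ≤ t)
    (ht₂ : t ≤ t₂) : s ∈ sweep I v h t := by
  obtain ⟨hs, hsI, a, ha, has⟩ := mem_sweep.mp h₁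
  obtain ⟨-, -, b, hb, hbs⟩ := mem_sweep.mp h₂
  obtain ⟨p, q, hp, hq, hpq, rfl⟩ : t ∈ segment ℝ t₁ t₂ := by
    rw [segment_eq_Icc (ht₁.trans ht₂)]; exact ⟨ht₁, ht₂⟩
  have key : ∀ i, h i + (p • t₁ + q • t₂) = p * (h i + t₁) + q * (h i + t₂) := fun i => by
    simp only [smul_eq_mul]; linear_combination (-h i) * hpq
  refine mem_sweep.mpr ⟨hs, hsI, p • a + q • b, fun i hi => ?_, fun i hi => ?_⟩
  · rw [key]
    exact add_le_add (mul_le_mul_of_nonneg_left (ha i hi) hp)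
      (mul_le_mul_of_nonneg_left (hb i hi) hq)
  · rw [key, ← has i hi, ← hbs i hi]
    simp

/-- `T` is the set of tight inequalities at a vertex of the polyhedron that lies at level `t`. -/
def IsCriticalAt (I : Finset ι) (v : ι → E) (h : ι → ℝ) (t : ℝ) (T : Finset ι) : Prop :=
  T.card = Module.finrank ℝ E + 1 ∧ T ∈ sweep I v h t

theorem IsCriticalAt.subset {I : Finset ι} {v : ι → E} {h : ι → ℝ} {t : ℝ} {T : Finset ι}
    (hT : IsCriticalAt I v h t T) : T ⊆ I :=
  (mem_sweep.mp hT.2).2.1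

theorem IsCriticalAt.isTightAt {I : Finset ι} {v : ι → E} {h : ι → ℝ} {t : ℝ} {T : Finset ι}
    (hT : IsCriticalAt I v h t T) : IsTightAt v h t T :=
  (mem_sweep.mp hT.2).2.2.imp fun _ ha => ha.2

namespace IsGenericSweep

variable [FiniteDimensional ℝ E] {I : Finset ι} {v : ι → E} {h : ι → ℝ} {s T : Finset ι}
  {r r₁ r₂ t₀ : ℝ}

theorem isClosed_setOf_mem (H : IsGenericSweep I v h) (s : Finset ι) :
    IsClosed {t | s ∈ sweep I v h t} :=
  isClosed_setOf_mem_polarComplex H.surroundsOrigin (fun i => by fun_prop) s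

/-- Continuous induction: the set of good levels is closed, so it only has to be open to the right.
-/
theorem mem_of_persists_up (H : IsGenericSweep I v h) (hr : r₁ ≤ r₂) (h₁ : s ∈ sweep I v h r₁)
    (hs : ∀ x ∈ Set.Ico r₁ r₂, s ∈ sweep I v h x → ∀ᶠ y in 𝓝[>] x, s ∈ sweep I v h y) :
    s ∈ sweep I v h r₂ := by
  refine ((H.isClosed_setOf_mem s).inter isClosed_Icc).mem_of_ge_of_forall_exists_gt h₁ hr ?_
  intro x hx
  obtain ⟨y, hy, hyx⟩ := ((hs x hx.2 hx.1).and (Ioc_mem_nhdsGT hx.2.2)).exists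
  exact ⟨y, hy, hyx⟩

theorem mem_of_persists_down (H : IsGenericSweep I v h) (hr : r₁ ≤ r₂) (h₂ : s ∈ sweep I v h r₂)
    (hs : ∀ x ∈ Set.Ioc r₁ r₂, s ∈ sweep I v h x → ∀ᶠ y in 𝓝[<] x, s ∈ sweep I v h y) :
    s ∈ sweep I v h r₁ := by
  refine ((H.isClosed_setOf_mem s).inter isClosed_Icc).mem_of_ge_of_forall_exists_lt h₂ hr ?_
  intro x hx
  obtain ⟨y, hy, hyx⟩ := ((hs x hx.2 hx.1).and (Ico_mem_nhdsLT hx.2.1)).exists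
  exact ⟨y, hy, hyx⟩

omit [FiniteDimensional ℝ E] in
theorem eventually_mem_sweep (hs : s.Nonempty) (hsI : s ⊆ I) {a w : E →L[ℝ] ℝ} {t : ℝ}
    (ha : ∀ i ∈ I, a (v i) ≤ h i + t) (has : ∀ i ∈ s, a (v i) = h i + t)
    (hws : ∀ i ∈ s, w (v i) = 1) {l : Filter ℝ} (hl : l ≤ 𝓝 t)
    (hw : ∀ i ∈ I, a (v i) = h i + t → ∀ᶠ x in l, (x - t) * w (v i) ≤ x - t) :
    ∀ᶠ x in l, s ∈ sweep I v h x := by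
  have hl' : Filter.map (fun x => x - t) l ≤ 𝓝 0 := by
    have : Tendsto (fun x : ℝ => x - t) (𝓝 t) (𝓝 (t - t)) := tendsto_id.sub_const t
    rw [sub_self] at this
    exact this.mono_left hl
  have := eventually_mem_polarComplex (g := fun _ => 1) hs hsI ha has hws hl' fun i hi hia => by
    simpa using hw i hi hia
  rw [eventually_map] at this
  filter_upwards [this] with x hx
  have e : (fun i => h i + t + (x - t) * 1) = fun i => h i + x := by ext i; ring
  rwa [e] at hx

/-- Away from critical sets the full tight set is linearly independent, so some direction `w` raises
all its members at the same rate as the level and keeps them all tight. -/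
theorem eventually_mem (H : IsGenericSweep I v h) {t : ℝ} (hs : s ∈ sweep I v h t)
    (hc : ∀ T, IsCriticalAt I v h t T → ¬ s ⊆ T) : ∀ᶠ x in 𝓝 t, s ∈ sweep I v h x := by
  classical
  obtain ⟨hne, hsI, a, ha, has⟩ := hs
  have hTI : I.filter (fun i => a (v i) = h i + t) ⊆ I := Finset.filter_subset _ _
  have hsT : s ⊆ I.filter fun i => a (v i) = h i + t := fun i hi =>
    Finset.mem_filter.mpr ⟨hsI hi, has i hi⟩
  have hT : IsTightAt v h t (I.filter fun i => a (v i) = h i + t) :=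
    ⟨a, fun i hi => (Finset.mem_filter.mp hi).2⟩
  have hcard := not_lt.mp fun hlt => hc _ ⟨(H.circuit t _ hTI hT hlt).1,
    hne.mono hsT, hTI, a, ha, fun i hi => (Finset.mem_filter.mp hi).2⟩ hsT
  obtain ⟨w, hw⟩ := exists_apply_eq (H.linearIndependent t _ hTI hT hcard) fun _ => 1
  refine eventually_mem_sweep hne hsI ha has (fun i hi => hw i (hsT hi)) le_rfl fun i hi hia => ?_
  rw [hw i (Finset.mem_filter.mpr ⟨hi, hia⟩)]
  simp

/-- Dropping `i₀` leaves a linearly independent set that can be kept tight. The inequality `i₀` then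
acquires slack `(x - t₀) / l i₀`, so the sign of `l i₀` decides on which side of `t₀` this is
feasible. -/
theorem eventually_mem_of_notMem (H : IsGenericSweep I v h) (hT : IsCriticalAt I v h t₀ T)
    {l : ι → ℝ} (hl1 : ∑ i ∈ T, l i = 1) (hlv : ∑ i ∈ T, l i • v i = 0) {i₀ : ι} (hi₀ : i₀ ∈ T)
    (hl0 : l i₀ ≠ 0) (hne : s.Nonempty) (hsT : s ⊆ T)
    (hs : i₀ ∉ s) {f : Filter ℝ} (hf : f ≤ 𝓝 t₀) (hfl : ∀ᶠ x in f, 0 ≤ (x - t₀) * l i₀) :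
    ∀ᶠ x in f, s ∈ sweep I v h x := by
  classical
  obtain ⟨hTcard, -, hTI, a, ha, haT⟩ := hT
  -- By genericity no further inequality is tight at the vertex.
  have htight : ∀ i ∈ I, a (v i) = h i + t₀ → i ∈ T := by
    intro i hi hia
    by_contra hiT
    have hsub : insert i T ⊆ I := Finset.insert_subset hi hTI
    have := (H.circuit t₀ _ hsub ⟨a, fun j hj => by
      rcases Finset.mem_insert.mp hj with rfl | hj
      exacts [hia, haT j hj]⟩ (by rw [Finset.card_insert_of_notMem hiT, hTcard]; omega)).1
    rw [Finset.card_insert_of_notMem hiT, hTcard] at this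
    omega
  obtain ⟨w, hw⟩ := exists_apply_eq (H.linearIndependent t₀ (T.erase i₀)
    ((T.erase_subset i₀).trans hTI) ⟨a, fun i hi => haT i (Finset.mem_of_mem_erase hi)⟩
    (by rw [Finset.card_erase_of_mem hi₀, hTcard]; omega)) fun _ => 1
  -- Apply `w` to the relation among the `v i`; all terms but one have `w (v i) = 1`.
  have hrel : l i₀ * w (v i₀) = l i₀ - 1 := by
    have h1 : ∑ i ∈ T, l i * w (v i) = 0 := by simpa using congrArg w hlv
    rw [← Finset.add_sum_erase _ _ hi₀] at h1 hl1
    rw [Finset.sum_congr rfl fun i hi => by rw [hw i hi, mul_one]] at h1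
    linarith
  refine eventually_mem_sweep hne (hsT.trans hTI) ha (fun i hi => haT i (hsT hi))
    (fun i hi => hw i (Finset.mem_erase.mpr ⟨fun e => hs (e ▸ hi), hsT hi⟩)) hf fun i hi hia => ?_
  rcases eq_or_ne i i₀ with rfl | hii
  · filter_upwards [hfl] with x hx
    have hwi : w (v i) = 1 - (l i)⁻¹ := by field_simp; linarith
    have : 0 ≤ (x - t₀) * (l i)⁻¹ := by
      have := mul_nonneg hx (sq_nonneg (l i)⁻¹)
      have e : (x - t₀) * l i * (l i)⁻¹ ^ 2 = (x - t₀) * (l i)⁻¹ := by field_simp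
      rwa [e] at this
    rw [hwi]; linarith
  · rw [hw i (Finset.mem_erase.mpr ⟨hii, htight i hi hia⟩)]
    simp

omit [FiniteDimensional ℝ E] in
-- The relation kills every functional, so only the right-hand sides contribute and the result does
-- not depend on `a`.
theorem sum_mul_slack {l : ι → ℝ} (hl1 : ∑ i ∈ T, l i = 1) (hlv : ∑ i ∈ T, l i • v i = 0)
    (hT : IsTightAt v h t₀ T) (a : E →L[ℝ] ℝ) (r : ℝ) :
    ∑ i ∈ T, l i * (h i + r - a (v i)) = r - t₀ := by
  obtain ⟨b, hb⟩ := hT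
  have h1 : ∑ i ∈ T, l i * a (v i) = 0 := by simpa using congrArg a hlv
  have h2 : ∑ i ∈ T, l i * b (v i) = 0 := by simpa using congrArg b hlv
  have h3 : ∀ i ∈ T, l i * (h i + r - a (v i)) = l i * b (v i) - l i * a (v i) + (r - t₀) * l i :=
    fun i hi => by rw [hb i hi]; ring
  rw [Finset.sum_congr rfl h3, Finset.sum_add_distrib, Finset.sum_sub_distrib, h1, h2,
    ← Finset.mul_sum, hl1]
  ring

omit [FiniteDimensional ℝ E] in
theorem isCriticalAt_unique (H : IsGenericSweep I v h) {T' : Finset ι}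
    (hT : IsCriticalAt I v h t₀ T) (hT' : IsCriticalAt I v h t₀ T') : T = T' :=
  H.unique t₀ T hT.subset T' hT'.subset hT.isTightAt hT'.isTightAt hT.1 hT'.1

omit [FiniteDimensional ℝ E] in
theorem exists_circuit (H : IsGenericSweep I v h) (hT : IsCriticalAt I v h t₀ T) :
    ∃ l : ι → ℝ, ∑ i ∈ T, l i = 1 ∧ ∑ i ∈ T, l i • v i = 0 ∧ ∀ i ∈ T, l i ≠ 0 :=
  (H.circuit t₀ T hT.subset hT.isTightAt (by rw [hT.1]; omega)).2

omit [FiniteDimensional ℝ E] in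
-- A given `T` is critical at one level only, since the level is determined by the linear relation
-- on `T`.
theorem finite_criticalLevels (H : IsGenericSweep I v h) :
    {t | ∃ T, IsCriticalAt I v h t T}.Finite := by
  refine (I.powerset.finite_toSet.biUnion (t := fun T => {t | IsCriticalAt I v h t T})
    fun T _ => Set.Subsingleton.finite ?_).subset fun t ⟨T, hT⟩ =>
      Set.mem_biUnion (Finset.mem_coe.mpr (Finset.mem_powerset.mpr hT.subset)) hT
  intro t ht t' ht'
  obtain ⟨l, hl1, hlv, -⟩ := H.exists_circuit ht
  obtain ⟨a, ha⟩ := ht'.isTightAt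
  have := sum_mul_slack hl1 hlv ht.isTightAt a t'
  rw [Finset.sum_eq_zero fun i hi => by rw [ha i hi, sub_self, mul_zero]] at this
  linarith

/-! ### Crossing a single critical level -/

section Crossing

variable (H : IsGenericSweep I v h) (hT : IsCriticalAt I v h t₀ T) (h₁ : r₁ < t₀) (h₂ : t₀ < r₂)
  (hc : ∀ t ∈ Set.Icc r₁ r₂, ∀ T', IsCriticalAt I v h t T' → t = t₀)

include H hT h₁ h₂ hc

theorem mem_sweep_iff_of_not_subset (hs : ¬ s ⊆ T) :
    s ∈ sweep I v h r₁ ↔ s ∈ sweep I v h r₂ := by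
  have key : ∀ x ∈ Set.Icc r₁ r₂, s ∈ sweep I v h x → ∀ᶠ y in 𝓝 x, s ∈ sweep I v h y := by
    intro x hx hsx
    refine H.eventually_mem hsx fun T' hT' hsT => ?_
    obtain rfl := hc x hx T' hT'
    exact hs (isCriticalAt_unique H hT hT' ▸ hsT)
  exact ⟨fun h => H.mem_of_persists_up (h₁.trans h₂).le h fun x hx hsx =>
      nhdsWithin_le_nhds (key x (Set.Ico_subset_Icc_self hx) hsx),
    fun h => H.mem_of_persists_down (h₁.trans h₂).le h fun x hx hsx =>
      nhdsWithin_le_nhds (key x (Set.Ioc_subset_Icc_self hx) hsx)⟩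

/-- Above `t₀` the weighted slack is positive, so some term is; its index is not tight and has `l i
> 0`. Conversely, such an index can be released to carry `s` upwards from level `t₀`. -/
theorem mem_sweep_above_iff {l : ι → ℝ} (hl1 : ∑ i ∈ T, l i = 1)
    (hlv : ∑ i ∈ T, l i • v i = 0) (hne : s.Nonempty) (hsT : s ⊆ T) :
    s ∈ sweep I v h r₂ ↔ ∃ i ∈ T, i ∉ s ∧ 0 < l i := by
  constructor
  · rintro ⟨-, -, a, ha, has⟩
    have hpos : 0 < ∑ i ∈ T, l i * (h i + r₂ - a (v i)) := by
      rw [sum_mul_slack hl1 hlv hT.isTightAt]; linarith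
    obtain ⟨i, hi, hli⟩ := Finset.exists_lt_of_sum_lt (s := T) (f := fun _ => (0 : ℝ))
      (by simpa using hpos)
    have hslack : 0 ≤ h i + r₂ - a (v i) := sub_nonneg.mpr (ha i (hT.subset hi))
    refine ⟨i, hi, fun his => ?_, pos_of_mul_pos_left hli hslack⟩
    rw [has i his, sub_self, mul_zero] at hli
    exact hli.false
  · rintro ⟨i, hi, his, hli⟩
    refine H.mem_of_persists_up h₂.le ((sweep I v h t₀).isRelLowerSet_faces hT.2 |>.2 hsT hne)
      fun x hx hsx => ?_
    rcases hx.1.eq_or_lt with rfl | hlt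
    · refine H.eventually_mem_of_notMem hT hl1 hlv hi hli.ne' hne hsT his nhdsWithin_le_nhds ?_
      filter_upwards [self_mem_nhdsWithin] with y hy
      exact mul_nonneg (sub_nonneg.mpr (le_of_lt hy)) hli.le
    · exact nhdsWithin_le_nhds (H.eventually_mem hsx fun T' hT' _ =>
        hlt.ne' (hc x ⟨h₁.le.trans hx.1, hx.2.le⟩ T' hT'))

theorem mem_sweep_below_iff {l : ι → ℝ} (hl1 : ∑ i ∈ T, l i = 1)
    (hlv : ∑ i ∈ T, l i • v i = 0) (hne : s.Nonempty) (hsT : s ⊆ T) :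
    s ∈ sweep I v h r₁ ↔ ∃ i ∈ T, i ∉ s ∧ l i < 0 := by
  constructor
  · rintro ⟨-, -, a, ha, has⟩
    have hneg : ∑ i ∈ T, l i * (h i + r₁ - a (v i)) < 0 := by
      rw [sum_mul_slack hl1 hlv hT.isTightAt]; linarith
    obtain ⟨i, hi, hli⟩ := Finset.exists_lt_of_sum_lt (s := T) (g := fun _ => (0 : ℝ))
      (by simpa using hneg)
    have hslack : 0 ≤ h i + r₁ - a (v i) := sub_nonneg.mpr (ha i (hT.subset hi))
    refine ⟨i, hi, fun his => ?_, neg_of_mul_neg_left hli hslack⟩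
    rw [has i his, sub_self, mul_zero] at hli
    exact hli.false
  · rintro ⟨i, hi, his, hli⟩
    refine H.mem_of_persists_down h₁.le ((sweep I v h t₀).isRelLowerSet_faces hT.2 |>.2 hsT hne)
      fun x hx hsx => ?_
    rcases hx.2.eq_or_lt with rfl | hlt
    · refine H.eventually_mem_of_notMem hT hl1 hlv hi hli.ne hne hsT his nhdsWithin_le_nhds ?_
      filter_upwards [self_mem_nhdsWithin] with y hy
      exact mul_nonneg_of_nonpos_of_nonpos (sub_nonpos.mpr (le_of_lt hy)) hli.le
    · exact nhdsWithin_le_nhds (H.eventually_mem hsx fun T' hT' _ =>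
        hlt.ne (hc x ⟨hx.1.le, hx.2.trans h₂.le⟩ T' hT'))

end Crossing

end IsGenericSweep

end Polar

end PreAbstractSimplicialComplex

namespace PreAbstractSimplicialComplex

/-! ### Joins, and crossings as bistellar moves -/

section Join

variable {V : Type*} [DecidableEq V] {α β s : Finset V}

omit [DecidableEq V] in
theorem isFace_simplex : (simplex α).IsFace s ↔ s ⊆ α := by
  refine ⟨fun h => ?_, fun h => ?_⟩
  · rcases h with rfl | h
    exacts [Finset.empty_subset _, h.2]
  · rcases s.eq_empty_or_nonempty with rfl | hs
    exacts [Or.inl rfl, Or.inr ⟨hs, h⟩]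

omit [DecidableEq V] in
theorem isFace_simplexBoundary (hα : α.Nonempty) : (simplexBoundary α).IsFace s ↔ s ⊂ α := by
  refine ⟨fun h => ?_, fun h => ?_⟩
  · rcases h with rfl | h
    exacts [Finset.empty_ssubset.mpr hα, h.2]
  · rcases s.eq_empty_or_nonempty with rfl | hs
    exacts [Or.inl rfl, Or.inr ⟨hs, h⟩]

theorem mem_join_simplex_simplexBoundary (hd : Disjoint α β) (hβ : β.Nonempty) :
    s ∈ (simplex α).join (simplexBoundary β) ↔ s.Nonempty ∧ s ⊆ α ∪ β ∧ ¬ β ⊆ s := by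
  constructor
  · rintro ⟨hs, σ, τ, hσ, hτ, -, rfl⟩
    rw [isFace_simplex] at hσ
    rw [isFace_simplexBoundary hβ] at hτ
    refine ⟨hs, Finset.union_subset_union hσ hτ.1, fun h => hτ.2 fun x hx => ?_⟩
    rcases Finset.mem_union.mp (h hx) with hx' | hx'
    exacts [(Finset.disjoint_left.mp hd (hσ hx') hx).elim, hx']
  · rintro ⟨hs, hsub, hβs⟩
    refine ⟨hs, s ∩ α, s ∩ β, isFace_simplex.mpr Finset.inter_subset_right,
      (isFace_simplexBoundary hβ).mpr ⟨Finset.inter_subset_right, fun h =>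
        hβs (h.trans Finset.inter_subset_left)⟩,
      hd.mono Finset.inter_subset_right Finset.inter_subset_right, ?_⟩
    rw [← Finset.inter_union_distrib_left, Finset.inter_eq_left.mpr hsub]

theorem mem_join_simplexBoundary_simplex (hd : Disjoint α β) (hα : α.Nonempty) :
    s ∈ (simplexBoundary α).join (simplex β) ↔ s.Nonempty ∧ s ⊆ α ∪ β ∧ ¬ α ⊆ s := by
  rw [Finset.union_comm, ← mem_join_simplex_simplexBoundary hd.symm hα]
  constructor <;> exact fun ⟨hs, σ, τ, hσ, hτ, h, e⟩ =>
    ⟨hs, τ, σ, hτ, hσ, h.symm, by rw [e, Finset.union_comm]⟩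

end Join

namespace IsGenericSweep

section

variable {ι E : Type*} [NormedAddCommGroup E] [NormedSpace ℝ E] [FiniteDimensional ℝ E]
  {I : Finset ι} {v : ι → E} {h : ι → ℝ} {s T : Finset ι} {r r₁ r₂ t₀ : ℝ} {d : ℕ}

omit [FiniteDimensional ℝ E] in
theorem card_le_of_mem (H : IsGenericSweep I v h) (hs : s ∈ sweep I v h r)
    (hr : ∀ T, ¬ IsCriticalAt I v h r T) : s.card ≤ Module.finrank ℝ E := by
  by_contra! hlt
  obtain ⟨-, hsI, a, ha, has⟩ := id hs
  exact hr s ⟨(H.circuit r s hsI ⟨a, has⟩ hlt).1, hs⟩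

variable [DecidableEq ι]

/-- As no coefficient vanishes, the two sign classes partition `T`. A nonempty subset of `T` is a
face below iff it misses a point of `β`, and above iff it misses a point of `α`; sets not inside `T`
are unaffected. -/
theorem isBistellarMove (H : IsGenericSweep I v h) (hd : Module.finrank ℝ E = d + 1)
    (hT : IsCriticalAt I v h t₀ T) (h₁ : r₁ < t₀) (h₂ : t₀ < r₂)
    (hc : ∀ t ∈ Set.Icc r₁ r₂, ∀ T', IsCriticalAt I v h t T' → t = t₀) {l : ι → ℝ}
    (hl1 : ∑ i ∈ T, l i = 1) (hlv : ∑ i ∈ T, l i • v i = 0) (hl0 : ∀ i ∈ T, l i ≠ 0)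
    (hneg : ∃ i ∈ T, l i < 0) :
    IsBistellarMove d (sweep I v h r₁) (sweep I v h r₂) (T.filter fun i => 0 < l i)
      (T.filter fun i => l i < 0) := by
  set α := T.filter fun i => 0 < l i with hα
  set β := T.filter fun i => l i < 0 with hβ
  have hαβ : Disjoint α β := Finset.disjoint_left.mpr fun i hi hi' =>
    lt_asymm (Finset.mem_filter.mp hi).2 (Finset.mem_filter.mp hi').2
  have hun : α ∪ β = T := by
    rw [hα, hβ, ← Finset.filter_or, Finset.filter_true_of_mem fun i hi => (hl0 i hi).lt_or_gt.symm]
  have hαne : α.Nonempty := by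
    obtain ⟨i, hi, hli⟩ := Finset.exists_lt_of_sum_lt (s := T) (f := fun _ => (0 : ℝ)) (g := l)
      (by simp [hl1])
    exact ⟨i, Finset.mem_filter.mpr ⟨hi, hli⟩⟩
  have hβne : β.Nonempty := hneg.imp fun i hi => Finset.mem_filter.mpr hi
  have below : ∀ s : Finset ι, s.Nonempty → s ⊆ T → (s ∈ sweep I v h r₁ ↔ ¬ β ⊆ s) := by
    intro s hs hsT
    rw [mem_sweep_below_iff H hT h₁ h₂ hc hl1 hlv hs hsT, Finset.not_subset]
    simp only [hβ, Finset.mem_filter]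
    exact exists_congr fun i => by tauto
  have above : ∀ s : Finset ι, s.Nonempty → s ⊆ T → (s ∈ sweep I v h r₂ ↔ ¬ α ⊆ s) := by
    intro s hs hsT
    rw [mem_sweep_above_iff H hT h₁ h₂ hc hl1 hlv hs hsT, Finset.not_subset]
    simp only [hα, Finset.mem_filter]
    exact exists_congr fun i => by tauto
  refine ⟨⟨?_, fun s hs => ?_⟩, hαne, hβne, hαβ, ?_, ?_, ?_⟩
  · obtain ⟨i, hi⟩ := hβne
    have hiT : i ∈ T := hun ▸ Finset.mem_union_right _ hi
    have hcard : (T.erase i).card = d + 1 := by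
      rw [Finset.card_erase_of_mem hiT, hT.1, hd]; rfl
    exact ⟨T.erase i, (below _ (Finset.card_pos.mp (by omega)) (T.erase_subset i)).mpr fun h =>
      Finset.notMem_erase i T (h hi), hcard⟩
  · rw [← hd]
    exact H.card_le_of_mem hs fun T' hT' => h₁.ne (hc r₁ ⟨le_rfl, (h₁.trans h₂).le⟩ T' hT')
  · rw [← Finset.card_union_of_disjoint hαβ, hun, hT.1, hd]
  · refine SetLike.ext fun s => ?_
    rw [mem_join_simplex_simplexBoundary hαβ hβne, hun]
    constructor
    · rintro ⟨hs, hsT⟩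
      have hne := ((sweep I v h r₁).isRelLowerSet_faces hs).1
      have hsT := Finset.coe_subset.mp hsT
      exact ⟨hne, hsT, (below s hne hsT).mp hs⟩
    · rintro ⟨hne, hsT, hβs⟩
      exact ⟨(below s hne hsT).mpr hβs, Finset.coe_subset.mpr hsT⟩
  · ext s
    change s ∈ sweep I v h r₂ ↔ (s ∈ sweep I v h r₁ ∧ ¬ s ∈ (simplex α).join (simplexBoundary β)) ∨
      s ∈ (simplexBoundary α).join (simplex β)
    rw [mem_join_simplex_simplexBoundary hαβ hβne, mem_join_simplexBoundary_simplex hαβ hαne, hun]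
    by_cases hsT : s ⊆ T
    · have h1 := below s
      have h2 := above s
      have h3 : s ∈ sweep I v h r₁ → s.Nonempty := fun hs => hs.1
      have h4 : s ∈ sweep I v h r₂ → s.Nonempty := fun hs => hs.1
      tauto
    · have := mem_sweep_iff_of_not_subset H hT h₁ h₂ hc hsT
      tauto

theorem sweep_eq_simplexBoundary (H : IsGenericSweep I v h)
    (hT : IsCriticalAt I v h t₀ T) (h₁ : r₁ < t₀) (h₂ : t₀ < r₂)
    (hc : ∀ t ∈ Set.Icc r₁ r₂, ∀ T', IsCriticalAt I v h t T' → t = t₀) {l : ι → ℝ}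
    (hl1 : ∑ i ∈ T, l i = 1) (hlv : ∑ i ∈ T, l i • v i = 0) (hl0 : ∀ i ∈ T, 0 < l i)
    (hempty : ∀ s, s ∉ sweep I v h r₁) : sweep I v h r₂ = simplexBoundary T := by
  refine SetLike.ext fun s => ?_
  constructor
  · intro hs
    have hsT : s ⊆ T := by
      by_contra hsT
      exact hempty s ((mem_sweep_iff_of_not_subset H hT h₁ h₂ hc hsT).mpr hs)
    obtain ⟨i, hi, his, -⟩ := (mem_sweep_above_iff H hT h₁ h₂ hc hl1 hlv hs.1 hsT).mp hs
    exact ⟨hs.1, hsT, fun h => his (h hi)⟩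
  · rintro ⟨hne, hsT, hTs⟩
    obtain ⟨i, hi, his⟩ := Finset.not_subset.mp hTs
    exact (mem_sweep_above_iff H hT h₁ h₂ hc hl1 hlv hne hsT).mpr ⟨i, hi, his, hl0 i hi⟩

omit [DecidableEq ι] in
-- With no critical level on the way, a face would persist down to a level where all right-hand
-- sides are negative, yet every functional is nonnegative at some `v i`.
theorem notMem_sweep_of_forall_not_isCriticalAt (H : IsGenericSweep I v h)
    (hr : ∀ t ≤ r, ∀ T, ¬ IsCriticalAt I v h t T) (s : Finset ι) : s ∉ sweep I v h r := by
  intro hs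
  obtain ⟨ρ, hρ, hρv⟩ := H.surroundsOrigin
  obtain ⟨M, hM⟩ : ∃ M, ∀ i ∈ I, h i ≤ M := by
    obtain ⟨M, hM⟩ := (I.image h).exists_le
    exact ⟨M, fun i hi => hM _ (Finset.mem_image_of_mem h hi)⟩
  have hlow : s ∈ sweep I v h (min r (-M - 1)) :=
    H.mem_of_persists_down (min_le_left _ _) hs fun x hx hsx =>
      nhdsWithin_le_nhds (H.eventually_mem hsx fun T hT => (hr x hx.2 T hT).elim)
  obtain ⟨-, -, a, ha, -⟩ := mem_sweep.mp hlow
  obtain ⟨i, hi, hia⟩ := hρv a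
  have h1 := mul_nonneg hρ.le (norm_nonneg a)
  have h2 := min_le_right r (-M - 1)
  linarith [ha i hi, hM i hi]

end

/-- The levels of a generic sweep are obtained from the standard sphere by bistellar moves. A move
`α ↦ β` destroys `α` for ever, so small sets that are faces at the end bound the index. -/
theorem reflTransGen_simplexBoundary_sweep {E : Type*} [NormedAddCommGroup E] [NormedSpace ℝ E]
    [FiniteDimensional ℝ E] {I : Finset ℕ} {v : ℕ → E} {h : ℕ → ℝ} {d k : ℕ} {R : ℝ}
    (H : IsGenericSweep I v h) (hd : Module.finrank ℝ E = d + 1) (hk : k ≤ d)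
    (hR : ∀ T, ¬ IsCriticalAt I v h R T)
    (hnb : ∀ s ⊆ I, s.Nonempty → s.card ≤ k + 1 → s ∈ sweep I v h R)
    (hne : ∃ s, s ∈ sweep I v h R) :
    ∃ α : Finset ℕ, α.card = d + 2 ∧
      Relation.ReflTransGen (fun A B : PreAbstractSimplicialComplex ℕ =>
        ∃ i < d - k, IsBistellarMoveOfIndex d i A B) (simplexBoundary α) (sweep I v h R) := by
  set C := H.finite_criticalLevels.toFinset with hC
  have hmemC : ∀ {t}, t ∈ C ↔ ∃ T, IsCriticalAt I v h t T := by simp [hC]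
  -- Induction on the number of critical levels below `r`.
  have key : ∀ n, ∀ r ≤ R, (∀ T, ¬ IsCriticalAt I v h r T) → (C.filter (· < r)).card = n →
      (∀ s, s ∉ sweep I v h r) ∨ ∃ α : Finset ℕ, α.card = d + 2 ∧
        Relation.ReflTransGen (fun A B : PreAbstractSimplicialComplex ℕ =>
          ∃ i < d - k, IsBistellarMoveOfIndex d i A B) (simplexBoundary α) (sweep I v h r) := by
    intro n
    induction n with
    | zero =>
      intro r hrR hr hcard
      refine Or.inl (H.notMem_sweep_of_forall_not_isCriticalAt fun t ht T hT => ?_)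
      rcases ht.eq_or_lt with rfl | hlt
      · exact hr T hT
      · have := Finset.card_eq_zero.mp hcard
        exact Finset.notMem_empty t (this ▸ Finset.mem_filter.mpr ⟨hmemC.mpr ⟨T, hT⟩, hlt⟩)
    | succ n ih =>
      intro r hrR hr hcard
      have hCne : (C.filter (· < r)).Nonempty := Finset.card_pos.mp (by omega)
      set t₀ := (C.filter (· < r)).max' hCne with ht₀
      have ht₀mem := Finset.max'_mem _ hCne
      rw [← ht₀] at ht₀mem
      obtain ⟨ht₀C, ht₀r⟩ := Finset.mem_filter.mp ht₀mem
      obtain ⟨T, hT⟩ := hmemC.mp ht₀C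
      -- Choose `r'` so close below `t₀` that only the topmost critical level lies between `r'` and
      -- `r`.
      obtain ⟨r', hr't₀, hr'⟩ : ∃ r' < t₀, ∀ t ∈ C, t < t₀ → t < r' := by
        have h1 : ∀ᶠ x in 𝓝[<] t₀, ∀ t ∈ C, t < t₀ → t < x := by
          refine (Filter.eventually_all_finset C).mpr fun t _ => ?_
          by_cases htt : t < t₀
          · filter_upwards [Ioo_mem_nhdsLT htt] with x hx _ using hx.1
          · exact Eventually.of_forall fun x hx => (htt hx).elim
        obtain ⟨x, hx, hxt⟩ := (h1.and self_mem_nhdsWithin).exists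
        exact ⟨x, hxt, hx⟩
      have hc : ∀ t ∈ Set.Icc r' r, ∀ T', IsCriticalAt I v h t T' → t = t₀ := by
        intro t ht T' hT'
        have htr : t < r := lt_of_le_of_ne ht.2 fun e => hr T' (e ▸ hT')
        have htC := hmemC.mpr ⟨T', hT'⟩
        rcases (Finset.le_max' (C.filter (· < r)) t
          (Finset.mem_filter.mpr ⟨htC, htr⟩)).eq_or_lt with e | hlt
        · exact e
        · exact ((hr' t htC hlt).not_ge ht.1).elim
      have hr'crit : ∀ T, ¬ IsCriticalAt I v h r' T := fun T' hT' =>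
        hr't₀.ne (hc r' ⟨le_rfl, (hr't₀.trans ht₀r).le⟩ T' hT')
      have hcard' : (C.filter (· < r')).card = n := by
        have : C.filter (· < r') = (C.filter (· < r)).erase t₀ := by
          ext t
          simp only [Finset.mem_filter, Finset.mem_erase]
          constructor
          · rintro ⟨htC, ht⟩
            exact ⟨(ht.trans hr't₀).ne, htC, ht.trans (hr't₀.trans ht₀r)⟩
          · rintro ⟨htne, htC, ht⟩
            exact ⟨htC, hr' t htC (lt_of_le_of_ne (Finset.le_max' (C.filter (· < r)) t
              (Finset.mem_filter.mpr ⟨htC, ht⟩)) htne)⟩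
        rw [this, Finset.card_erase_of_mem ht₀mem, hcard, Nat.add_sub_cancel]
      obtain ⟨l, hl1, hlv, hl0⟩ := H.exists_circuit hT
      have ih' := ih r' ((hr't₀.trans ht₀r).le.trans hrR) hr'crit hcard'
      right
      by_cases hneg : ∃ i ∈ T, l i < 0
      · have hmove := H.isBistellarMove hd hT hr't₀ ht₀r hc hl1 hlv hl0 hneg
        rcases ih' with hempty | ⟨α, hα, hgen⟩
        · obtain ⟨⟨s, hs, -⟩, -⟩ := hmove.1
          exact (hempty s hs).elim
        refine ⟨α, hα, hgen.tail ?_⟩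
        obtain ⟨-, hαne, hβne, hαβ, hsum, -, -⟩ := id hmove
        set α' := T.filter fun i => 0 < l i with hα'
        set β' := T.filter fun i => l i < 0
        have hα'T : α' ⊆ T := Finset.filter_subset _ _
        -- A smaller `α'` would be a face at `t₀` and at `R`, hence at `r`, but the crossing has
        -- destroyed it.
        have hbig : k + 1 < α'.card := by
          by_contra! hle
          have hmem₀ : α' ∈ sweep I v h t₀ :=
            ((sweep I v h t₀).isRelLowerSet_faces hT.2).2 hα'T hαne
          have hmemR := hnb α' (hα'T.trans hT.subset) hαne hle
          have hmem := mem_sweep_of_mem_of_mem hmem₀ hmemR ht₀r.le hrR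
          obtain ⟨i, hi, hiα, hli⟩ := (mem_sweep_above_iff H hT hr't₀ ht₀r hc hl1 hlv hαne
            hα'T).mp hmem
          exact hiα (Finset.mem_filter.mpr ⟨hi, hli⟩)
        have hβpos := Finset.card_pos.mpr hβne
        exact ⟨β'.card - 1, by omega, α', β', by omega, hmove⟩
      · have hpos : ∀ i ∈ T, 0 < l i := fun i hi =>
          lt_of_le_of_ne (not_lt.mp fun hlt => hneg ⟨i, hi, hlt⟩) (hl0 i hi).symm
        refine ⟨T, by rw [hT.1, hd], ?_⟩
        rw [H.sweep_eq_simplexBoundary hT hr't₀ ht₀r hc hl1 hlv hpos]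
        -- With all coefficients positive, the weighted slack below `t₀` would be both nonnegative
        -- and negative, so the earlier level is empty.
        rintro s ⟨-, -, a, ha, -⟩
        have h1 := sum_mul_slack hl1 hlv hT.isTightAt a r'
        have h2 : 0 ≤ ∑ i ∈ T, l i * (h i + r' - a (v i)) := Finset.sum_nonneg fun i hi =>
          mul_nonneg (hpos i hi).le (sub_nonneg.mpr (ha i (hT.subset hi)))
        linarith
  rcases key _ R le_rfl hR rfl with hempty | hgen
  · obtain ⟨s, hs⟩ := hne
    exact (hempty s hs).elim
  · exact hgen

end IsGenericSweep

end PreAbstractSimplicialComplex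

/-! ### Existence of a generic origin and a generic sweep -/

/-- Proper affine subspaces are Haar null, while nonempty open sets have positive measure. -/
theorem exists_mem_forall_notMem_affineSubspace {E : Type*} [NormedAddCommGroup E]
    [NormedSpace ℝ E] [FiniteDimensional ℝ E] {U : Set E} (hU : IsOpen U) (hne : U.Nonempty)
    {J : Type*} [Countable J] (A : J → AffineSubspace ℝ E) (hA : ∀ j, A j ≠ ⊤) :
    ∃ x ∈ U, ∀ j, x ∉ A j := by
  borelize E
  by_contra! hcon
  refine (hU.measure_pos MeasureTheory.Measure.addHaar hne).ne' (MeasureTheory.measure_mono_null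
    (t := ⋃ j, (A j : Set E)) (fun x hx => Set.mem_iUnion.mpr (hcon x hx))
    (MeasureTheory.measure_iUnion_null fun j =>
      MeasureTheory.Measure.addHaar_affineSubspace _ _ (hA j)))

/-- A real vector space is not a finite union of proper subspaces, here the kernels of nonzero
functionals. -/
theorem exists_forall_sum_mul_ne_zero {ι J : Type*} [Finite J] (I : Finset ι) (m : J → ι → ℝ) :
    ∃ h : ι → ℝ, ∀ j, (∃ i ∈ I, m j i ≠ 0) → ∑ i ∈ I, m j i * h i ≠ 0 := by
  classical
  let f : J → (ι → ℝ) →ₗ[ℝ] ℝ := fun j => ∑ i ∈ I, m j i • LinearMap.proj i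
  have hf : ∀ j h, f j h = ∑ i ∈ I, m j i * h i := fun j h => by
    simp [f, LinearMap.sum_apply]
  by_contra! hcon
  obtain ⟨⟨j, i, hi, hij⟩, hj⟩ := Subspace.exists_eq_top_of_iUnion_eq_univ
    (p := fun j : {j // ∃ i ∈ I, m j i ≠ 0} => LinearMap.ker (f j)) (by
      refine Set.eq_univ_of_forall fun h => ?_
      obtain ⟨j, hj, h0⟩ := hcon h
      exact Set.mem_iUnion.mpr ⟨⟨j, hj⟩, by rw [SetLike.mem_coe, LinearMap.mem_ker, hf, h0]⟩)
  have h0 : f j (Pi.single i 1) = 0 := by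
    have : Pi.single i 1 ∈ LinearMap.ker (f j) := by rw [hj]; trivial
    exact this
  rw [hf, Finset.sum_eq_single i (fun k _ hk => by simp [hk]) (fun h => (h hi).elim)] at h0
  exact hij (by simpa using h0)

theorem AffineIndependent.linearIndependent_of_zero_notMem {J E : Type*} [Fintype J]
    [AddCommGroup E] [Module ℝ E] {p : J → E} (hp : AffineIndependent ℝ p)
    (h0 : (0 : E) ∉ affineSpan ℝ (Set.range p)) : LinearIndependent ℝ p := by
  rw [Fintype.linearIndependent_iff]
  intro g hg
  by_cases hs : ∑ i, g i = 0
  · exact fun i => affineIndependent_iff.mp hp Finset.univ g hs hg i (Finset.mem_univ i)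
  · refine (h0 ?_).elim
    have h1 : ∑ i, (∑ i, g i)⁻¹ * g i = 1 := by rw [← Finset.mul_sum, inv_mul_cancel₀ hs]
    have h2 := affineCombination_mem_affineSpan (k := ℝ) (s := Finset.univ) h1 p
    rw [Finset.affineCombination_eq_linear_combination _ _ _ h1] at h2
    simpa [mul_smul, ← Finset.smul_sum, hg] using h2

namespace PreAbstractSimplicialComplex

variable {ι E : Type*} [NormedAddCommGroup E] [NormedSpace ℝ E]

/-- Coefficients of an affine combination of the points `v i` for `i ∈ T` that gives the origin and
uses all of them. -/
def IsOriginCombination (v : ι → E) (T : Finset ι) (l : ι → ℝ) : Prop :=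
  ∑ i ∈ T, l i = 1 ∧ ∑ i ∈ T, l i • v i = 0 ∧ ∀ i ∈ T, l i ≠ 0

/-- There are too many vectors to be linearly independent. Affine independence makes the coefficient
sum of a relation nonzero, so it can be normalised; a vanishing coefficient would put the origin in
the span of a smaller set. -/
theorem exists_isOriginCombination [FiniteDimensional ℝ E] {v : ι → E} {T : Finset ι}
    (hT : AffineIndependent ℝ fun i : T => v i) (hcard : T.card = Module.finrank ℝ E + 1)
    (h0 : ∀ s ⊆ T, s.card ≤ Module.finrank ℝ E → (0 : E) ∉ affineSpan ℝ (v '' s)) :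
    ∃ l, IsOriginCombination v T l := by
  classical
  have hdep : ¬ LinearIndependent ℝ fun i : T => v i := fun hli => by
    have := hli.fintype_card_le_finrank
    rw [Fintype.card_coe] at this
    omega
  obtain ⟨g, hg, hgne⟩ : ∃ g : ι → ℝ, ∑ i ∈ T, g i • v i = 0 ∧ ∃ i ∈ T, g i ≠ 0 := by
    rw [Fintype.not_linearIndependent_iff] at hdep
    obtain ⟨g, hg, i, hi⟩ := hdep
    refine ⟨fun i => if h : i ∈ T then g ⟨i, h⟩ else 0, ?_, i, i.2, by simpa using hi⟩
    rw [← hg, ← Finset.sum_coe_sort T]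
    simp
  have hs : ∑ i ∈ T, g i ≠ 0 := by
    intro hs
    obtain ⟨i, hi, hgi⟩ := hgne
    refine hgi (affineIndependent_iff.mp hT Finset.univ (fun i => g i) ?_ ?_ ⟨i, hi⟩
      (Finset.mem_univ _))
    · rw [Finset.sum_coe_sort T g, hs]
    · rw [Finset.sum_coe_sort T fun i => g i • v i, hg]
  have h1 : ∑ i ∈ T, (∑ i ∈ T, g i)⁻¹ * g i = 1 := by rw [← Finset.mul_sum, inv_mul_cancel₀ hs]
  have h2 : ∑ i ∈ T, ((∑ i ∈ T, g i)⁻¹ * g i) • v i = 0 := by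
    simp [mul_smul, ← Finset.smul_sum, hg]
  refine ⟨fun i => (∑ i ∈ T, g i)⁻¹ * g i, h1, h2, fun i hi hi0 => ?_⟩
  refine h0 (T.erase i) (T.erase_subset i) (by rw [Finset.card_erase_of_mem hi]; omega) ?_
  rw [← Finset.add_sum_erase _ _ hi] at h1 h2
  have hi0 : (∑ i ∈ T, g i)⁻¹ * g i = 0 := hi0
  rw [hi0, zero_add] at h1
  rw [hi0, zero_smul, zero_add] at h2
  rw [← Finset.sum_coe_sort] at h1 h2
  have h3 := affineCombination_mem_affineSpan (k := ℝ) (s := Finset.univ) h1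
    fun j : (T.erase i : Finset ι) => v j
  rw [Finset.affineCombination_eq_linear_combination _ _ _ h1, h2] at h3
  have e : Set.range (fun j : (T.erase i : Finset ι) => v j) = v '' (T.erase i : Finset ι) := by
    ext x; simp [and_comm]
  rwa [e] at h3

/-- If `T` is tight, `h` agrees on it with an affine function of `v`, so every affine dependence
among the `v i` annihilates `h`, and an origin combination `l` reads off the level as `-∑ l i * h
i`. It is enough that `h` avoids finitely many hyperplanes: one per affinely dependent set, and one
per pair of distinct sets that would share a level. -/
theorem exists_isGenericSweep [FiniteDimensional ℝ E] {I : Finset ι} {v : ι → E}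
    (hsur : SurroundsOrigin I v)
    (h0 : ∀ s ⊆ I, s.card ≤ Module.finrank ℝ E → (0 : E) ∉ affineSpan ℝ (v '' s)) :
    ∃ h, IsGenericSweep I v h := by
  classical
  have hdep : ∀ s : Finset ι, ∃ m : ι → ℝ, ¬ AffineIndependent ℝ (fun i : s => v i) →
      ∑ i ∈ s, m i = 0 ∧ ∑ i ∈ s, m i • v i = 0 ∧ ∃ i ∈ s, m i ≠ 0 := by
    intro s
    by_cases hs : AffineIndependent ℝ fun i : s => v i
    · exact ⟨0, fun h => (h hs).elim⟩
    · have hs' := hs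
      rw [affineIndependent_iff] at hs
      push Not at hs
      obtain ⟨u, w, hw0, hwv, i, hi, hwi⟩ := hs
      have hu : s.attach ∩ u = u := Finset.inter_eq_right.mpr fun i _ => Finset.mem_attach s i
      refine ⟨fun i => if h : i ∈ s then (if (⟨i, h⟩ : s) ∈ u then w ⟨i, h⟩ else 0) else 0,
        fun _ => ⟨?_, ?_, i, i.2, by simpa [hi] using hwi⟩⟩
      · rw [← Finset.sum_coe_sort s]
        simpa [hu] using hw0
      · rw [← Finset.sum_coe_sort s]
        simpa [hu] using hwv
  choose m hm using hdep
  have hcomb : ∀ T : Finset ι, ∃ l : ι → ℝ, (∃ l, IsOriginCombination v T l) →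
      IsOriginCombination v T l := fun T => by
    by_cases h : ∃ l, IsOriginCombination v T l
    · exact ⟨h.choose, fun _ => h.choose_spec⟩
    · exact ⟨0, fun h' => (h h').elim⟩
  choose L hL using hcomb
  let ext0 : Finset ι → (ι → ℝ) → ι → ℝ := fun T l i => if i ∈ T then l i else 0
  obtain ⟨h, hh⟩ := exists_forall_sum_mul_ne_zero (J := I.powerset ⊕ (I.powerset × I.powerset)) I
    (Sum.elim (fun s => ext0 s (m s)) fun p => ext0 p.1 (L p.1) - ext0 p.2 (L p.2))
  have hsum : ∀ T ⊆ I, ∀ l : ι → ℝ, ∑ i ∈ I, ext0 T l i * h i = ∑ i ∈ T, l i * h i := by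
    intro T hT l
    rw [← Finset.sum_subset hT fun i _ hi => by simp [ext0, hi]]
    exact Finset.sum_congr rfl fun i hi => by simp [ext0, hi]
  have hval : ∀ t T, IsTightAt v h t T → ∀ l : ι → ℝ, ∑ i ∈ T, l i • v i = 0 →
      ∑ i ∈ T, l i * h i = -(∑ i ∈ T, l i) * t := by
    rintro t T ⟨a, ha⟩ l hl
    have h1 : ∑ i ∈ T, l i * a (v i) = 0 := by simpa using congrArg a hl
    rw [Finset.sum_congr rfl fun i hi => by rw [ha i hi, mul_add], Finset.sum_add_distrib,
      ← Finset.sum_mul] at h1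
    linarith
  have haff : ∀ t, ∀ T ⊆ I, IsTightAt v h t T → AffineIndependent ℝ fun i : T => v i := by
    intro t T hTI hT
    by_contra hna
    obtain ⟨hm0, hmv, i, hi, hmi⟩ := hm T hna
    refine hh (Sum.inl ⟨T, Finset.mem_powerset.mpr hTI⟩) ⟨i, hTI hi, by simpa [ext0, hi]⟩ ?_
    rw [Sum.elim_inl, hsum T hTI, hval t T hT _ hmv, hm0]
    simp
  have hcirc : ∀ t, ∀ T ⊆ I, IsTightAt v h t T → T.card = Module.finrank ℝ E + 1 →
      ∃ l, IsOriginCombination v T l := fun t T hTI hT hc =>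
    exists_isOriginCombination (haff t T hTI hT) hc fun s hs => h0 s (hs.trans hTI)
  refine ⟨h, hsur, fun t T hTI hT hc => ?_, fun t T hTI hT hc => ?_,
    fun t T hTI T' hTI' hT hT' hc hc' => ?_⟩
  · refine (haff t T hTI hT).linearIndependent_of_zero_notMem ?_
    have e : Set.range (fun i : T => v i) = v '' T := by ext x; simp
    rw [e]
    exact h0 T hTI hc
  · have hle := (haff t T hTI hT).card_le_finrank_succ
    have hle' := Submodule.finrank_le (vectorSpan ℝ (Set.range fun i : T => v i))
    rw [Fintype.card_coe] at hle
    have hc' : T.card = Module.finrank ℝ E + 1 := by omega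
    exact ⟨hc', hcirc t T hTI hT hc'⟩
  · by_contra hne
    have hl := hL T (hcirc t T hTI hT hc)
    have hl' := hL T' (hcirc t T' hTI' hT' hc')
    refine hh (Sum.inr (⟨T, Finset.mem_powerset.mpr hTI⟩, ⟨T', Finset.mem_powerset.mpr hTI'⟩)) ?_ ?_
    · by_cases hsub : T ⊆ T'
      · exact (hne (Finset.eq_of_subset_of_card_le hsub (by omega))).elim
      · obtain ⟨i, hi, hi'⟩ := Finset.not_subset.mp hsub
        exact ⟨i, hTI hi, by simpa [ext0, hi, hi'] using hl.2.2 i hi⟩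
    · simp only [Sum.elim_inr, Pi.sub_apply, sub_mul, Finset.sum_sub_distrib]
      rw [hsum T hTI, hsum T' hTI', hval t T hT _ hl.2.1, hval t T' hT' _ hl'.2.1, hl.1, hl'.1,
        sub_self]

/-- Take `x` in the interior of the hull, off the finitely many affine spans of at most `finrank`
points, all proper by dimension. A ball around `x` in the hull contains a point where `a` is large,
and a vertex does at least as well. -/
theorem exists_surroundsOrigin_sub [FiniteDimensional ℝ E] {I : Finset ι} {q : ι → E}
    (hq : affineSpan ℝ (q '' I) = ⊤) :
    ∃ x, SurroundsOrigin I (fun i => q i - x) ∧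
      ∀ s ⊆ I, s.card ≤ Module.finrank ℝ E →
        (0 : E) ∉ affineSpan ℝ ((fun i => q i - x) '' s) := by
  classical
  have hne := interior_convexHull_nonempty_iff_affineSpan_eq_top.mpr hq
  have hfin : Finite {s : Finset ι // s ⊆ I ∧ s.card ≤ Module.finrank ℝ E} :=
    (I.powerset.finite_toSet.subset fun s hs => Finset.mem_coe.mpr
      (Finset.mem_powerset.mpr hs.1)).to_subtype
  obtain ⟨x, hx, hxs⟩ := exists_mem_forall_notMem_affineSubspace isOpen_interior hne
    (J := {s : Finset ι // s ⊆ I ∧ s.card ≤ Module.finrank ℝ E})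
    (fun s => affineSpan ℝ (q '' (s : Finset ι))) (by
      rintro ⟨s, hs, hcard⟩ htop
      rcases s.eq_empty_or_nonempty with rfl | hsne
      · simp only [Finset.coe_empty, Set.image_empty, AffineSubspace.span_empty] at htop
        exact AffineSubspace.bot_ne_top ℝ E E htop
      · obtain ⟨n, hn⟩ := Nat.exists_eq_succ_of_ne_zero (Finset.card_pos.mpr hsne).ne'
        have h1 := finrank_vectorSpan_image_finset_le ℝ q s hn
        rw [Finset.coe_image, ← direction_affineSpan, htop, AffineSubspace.direction_top,
          finrank_top] at h1
        omega)
  refine ⟨x, ?_, fun s hs hc h => ?_⟩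
  · obtain ⟨ρ, hρ, hball⟩ := Metric.mem_nhds_iff.mp (mem_interior_iff_mem_nhds.mp hx)
    refine ⟨ρ / 2, by positivity, fun a => ?_⟩
    have hpt : ∃ y ∈ convexHull ℝ (q '' I), ρ / 2 * ‖a‖ ≤ a (y - x) := by
      rcases eq_or_ne a 0 with rfl | ha
      · exact ⟨x, interior_subset hx, by simp⟩
      · obtain ⟨z, hz, haz⟩ := a.exists_lt_apply_of_lt_opNorm
          (half_lt_self (norm_pos_iff.mpr ha))
        obtain ⟨z', hz', haz'⟩ : ∃ z', ‖z'‖ < 1 ∧ ‖a‖ / 2 < a z' := by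
          rcases le_total 0 (a z) with h | h
          · exact ⟨z, hz, by rwa [Real.norm_of_nonneg h] at haz⟩
          · exact ⟨-z, by rwa [norm_neg], by rwa [map_neg, ← Real.norm_of_nonpos h]⟩
        refine ⟨x + ρ • z', hball ?_, ?_⟩
        · rw [mem_ball_iff_norm, add_sub_cancel_left, norm_smul, Real.norm_of_nonneg hρ.le]
          nlinarith
        · rw [add_sub_cancel_left, map_smul, smul_eq_mul]
          nlinarith
    obtain ⟨y, hy, hay⟩ := hpt
    obtain ⟨_, ⟨i, hi, rfl⟩, hiy⟩ := (a.toLinearMap.convexOn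
      (convex_convexHull ℝ (q '' I))).exists_ge_of_mem_convexHull (subset_convexHull ℝ _) hy
    refine ⟨i, hi, hay.trans ?_⟩
    rw [map_sub, map_sub]
    exact sub_le_sub_right hiy _
  · refine hxs ⟨s, hs, hc⟩ ?_
    have h1 := AffineSubspace.mem_map_of_mem (AffineEquiv.vaddConst ℝ x).toAffineMap h
    rw [AffineSubspace.map_span, Set.image_image] at h1
    simpa using h1

end PreAbstractSimplicialComplex

namespace PreAbstractSimplicialComplex

/-! ### Transport along isomorphisms -/

section Isomorphism

variable {V W Z : Type*} {X : PreAbstractSimplicialComplex V} {Y : PreAbstractSimplicialComplex W}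
  {K : PreAbstractSimplicialComplex Z}

theorem IsIsomorphic.trans (h₁ : X.IsIsomorphic Y) (h₂ : Y.IsIsomorphic K) : X.IsIsomorphic K := by
  obtain ⟨e, he⟩ := h₁
  obtain ⟨f, hf⟩ := h₂
  refine ⟨e.trans f, fun s => ?_⟩
  rw [he, hf, Finset.map_map e.toEmbedding f.toEmbedding, Equiv.trans_toEmbedding]

theorem IsNeighbourly.of_isIsomorphic {l : ℕ} (hX : X.IsNeighbourly l) (h : X.IsIsomorphic Y) :
    Y.IsNeighbourly l := by
  classical
  obtain ⟨e, he⟩ := h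
  intro s hs hcard
  obtain ⟨s', rfl⟩ : ∃ s' : Finset X.vertices,
      (s'.map e.toEmbedding).map (Function.Embedding.subtype _) = s := by
    refine ⟨(s.subtype (· ∈ Y.vertices)).map e.symm.toEmbedding, ?_⟩
    rw [Finset.map_map e.symm.toEmbedding, ← Equiv.trans_toEmbedding, Equiv.symm_trans_self, Equiv.refl_toEmbedding,
      Finset.map_refl]
    exact Finset.subtype_map_of_mem fun x hx => hs hx
  rcases hX (s'.map (Function.Embedding.subtype _)) (fun x hx => by
    obtain ⟨y, -, rfl⟩ := Finset.mem_map.mp (Finset.mem_coe.mp hx)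
    exact y.2) (by simpa using hcard) with h0 | hmem
  · exact Or.inl (by simpa using h0)
  · exact Or.inr ((he s').mp hmem)

theorem isIsomorphic_of_image [DecidableEq V] [DecidableEq W] (φ : W → V) (hinj : Set.InjOn φ Y.vertices)
    (him : φ '' Y.vertices = X.vertices)
    (hφ : ∀ s : Finset W, (s : Set W) ⊆ Y.vertices → (s.image φ ∈ X ↔ s ∈ Y)) :
    X.IsIsomorphic Y := by
  let e : Y.vertices ≃ X.vertices := (Equiv.Set.imageOfInjOn φ _ hinj).trans (Equiv.setCongr him)
  have he : ∀ y, (e y : V) = φ y := fun y => rfl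
  refine ⟨e.symm, fun s => ?_⟩
  rw [← hφ _ fun x hx => by
    obtain ⟨y, -, rfl⟩ := Finset.mem_map.mp (Finset.mem_coe.mp hx)
    exact y.2]
  have key : ((s.map e.symm.toEmbedding).map (Function.Embedding.subtype _)).image φ =
      s.map (Function.Embedding.subtype _) := by
    rw [Finset.map_map, Finset.map_eq_image, Finset.map_eq_image, Finset.image_image]
    refine Finset.image_congr fun x _ => ?_
    change φ (e.symm x) = x
    rw [← he, Equiv.apply_symm_apply]
  rw [key]

end Isomorphism

theorem SurroundsOrigin.pos {ι E : Type*} [NormedAddCommGroup E] [NormedSpace ℝ E] {I : Finset ι}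
    {v : ι → E} (hv : SurroundsOrigin I v) {a : E →L[ℝ] ℝ} (ha : a ≠ 0) {m : ℝ}
    (hm : ∀ i ∈ I, a (v i) ≤ m) : 0 < m := by
  obtain ⟨r, hr, hrv⟩ := hv
  obtain ⟨i, hi, hia⟩ := hrv a
  exact (mul_pos hr (norm_pos_iff.mpr ha)).trans_le (hia.trans (hm i hi))

/-! ### The boundary complex as a polar complex -/

section Polytope

variable {n : ℕ} {P : Set (EuclideanSpace ℝ (Fin n))} {ι : Type*} {I : Finset ι}
  {φ : ι → EuclideanSpace ℝ (Fin n)} {v : ι → vectorSpan ℝ P} {p : EuclideanSpace ℝ (Fin n)}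

theorem exists_isProperFace (hP : P = convexHull ℝ (φ '' I)) (hv : ∀ i, (v i : _) = φ i - p)
    (hsur : SurroundsOrigin I v) {a : vectorSpan ℝ P →L[ℝ] ℝ} (ha : ∀ i ∈ I, a (v i) ≤ 1) {i₀ : ι}
    (hi₀ : i₀ ∈ I) (ha₀ : a (v i₀) = 1) :
    ∃ F, IsProperFace P F ∧ ∀ i ∈ I, a (v i) = 1 → φ i ∈ F := by
  obtain ⟨l, hl, -⟩ := exists_extension_norm_eq (vectorSpan ℝ P) a
  have hφ : ∀ i, l (φ i) = a (v i) + l p := fun i => by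
    rw [← hl, hv, map_sub, sub_add_cancel]
  have hφP : ∀ i ∈ I, φ i ∈ P := fun i hi => by
    rw [hP]; exact subset_convexHull ℝ _ (Set.mem_image_of_mem φ hi)
  have hbound : ∀ y ∈ P, l y ≤ 1 + l p := by
    intro y hy
    rw [hP] at hy
    refine convexHull_min (t := {y | l y ≤ 1 + l p}) ?_
      (convex_halfSpace_le l.toLinearMap.isLinear _) hy
    rintro _ ⟨i, hi, rfl⟩
    rw [Set.mem_ofPred_eq, hφ]
    linarith [ha i hi]
  refine ⟨{x ∈ P | ∀ y ∈ P, l y ≤ l x}, ⟨fun _ => ⟨l, rfl⟩, fun hF => ?_⟩, fun i hi hai =>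
    ⟨hφP i hi, fun y hy => by rw [hφ i, hai]; exact hbound y hy⟩⟩
  -- The face is proper: testing `-a` yields a vertex where `a` is nonpositive, whereas its maximum
  -- is `1`.
  obtain ⟨r, hr, hrv⟩ := hsur
  obtain ⟨j, hj, hja⟩ := hrv (-a)
  have hjF : φ j ∈ {x ∈ P | ∀ y ∈ P, l y ≤ l x} := by
    rw [hF]; exact hφP j hj
  have h1 := hjF.2 (φ i₀) (hφP i₀ hi₀)
  rw [hφ, hφ, ha₀] at h1
  have h2 := mul_nonneg hr.le (norm_nonneg (-a))
  rw [neg_apply] at hja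
  linarith

/-- The functional exposing a proper face is not constant on `P`; as the origin is interior, its
maximum over the `v i` is positive and can be scaled to `1`. -/
theorem image_mem_polytopeBoundaryComplex_iff [DecidableEq (EuclideanSpace ℝ (Fin n))]
    (hP : P = convexHull ℝ (φ '' I)) (hext : P.extremePoints ℝ = φ '' I)
    (hv : ∀ i, (v i : _) = φ i - p) (hsur : SurroundsOrigin I v) {s : Finset ι} (hs : s ⊆ I) :
    s.image φ ∈ polytopeBoundaryComplex P ↔ s ∈ polarComplex I v fun _ => 1 := by
  have hφP : ∀ i ∈ I, φ i ∈ P := fun i hi => by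
    rw [hP]; exact subset_convexHull ℝ _ (Set.mem_image_of_mem φ hi)
  constructor
  · rintro ⟨hne, -, F, ⟨hF, hFP⟩, hsF⟩
    have hsne := Finset.image_nonempty.mp hne
    have hsF : ∀ i ∈ s, φ i ∈ F := fun i hi => hsF (Finset.mem_coe.mpr
      (Finset.mem_image_of_mem φ hi))
    obtain ⟨i₀, hi₀⟩ := id hsne
    obtain ⟨l, rfl⟩ := hF ⟨φ i₀, hsF i₀ hi₀⟩
    set a := l.comp (vectorSpan ℝ P).subtypeL with ha
    have hav : ∀ i, a (v i) = l (φ i) - l p := fun i => by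
      rw [ha, ContinuousLinearMap.comp_apply, Submodule.subtypeL_apply, hv, map_sub]
    have hmax : ∀ i ∈ s, ∀ j ∈ I, a (v j) ≤ a (v i) := fun i hi j hj => by
      rw [hav, hav]
      exact sub_le_sub_right ((hsF i hi).2 _ (hφP j hj)) _
    have ha0 : a ≠ 0 := by
      intro ha0
      refine hFP (Set.Subset.antisymm (fun x hx => hx.1) fun x hx => ⟨hx, fun y hy => ?_⟩)
      have h1 : a ⟨y - x, vsub_mem_vectorSpan ℝ hy hx⟩ = 0 := by rw [ha0]; rfl
      have h2 : l (y - x) = 0 := h1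
      rw [map_sub] at h2
      linarith
    have hm := hsur.pos ha0 (hmax i₀ hi₀)
    refine ⟨hsne, hs, (a (v i₀))⁻¹ • a, fun j hj => ?_, fun i hi => ?_⟩
    · change (a (v i₀))⁻¹ * a (v j) ≤ 1
      rw [inv_mul_le_one₀ hm]
      exact hmax i₀ hi₀ j hj
    · change (a (v i₀))⁻¹ * a (v i) = 1
      rw [le_antisymm (hmax i₀ hi₀ i (hs hi)) (hmax i hi i₀ (hs hi₀)), inv_mul_cancel₀ hm.ne']
  · rintro ⟨⟨i₀, hi₀⟩, -, a, ha, has⟩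
    obtain ⟨F, hF, hFs⟩ := exists_isProperFace hP hv hsur ha (hs hi₀) (has i₀ hi₀)
    refine ⟨⟨φ i₀, Finset.mem_image_of_mem φ hi₀⟩, ?_, F, hF, ?_⟩
    · rw [hext, Finset.coe_image]
      exact Set.image_mono hs
    · rw [Finset.coe_image]
      rintro _ ⟨i, hi, rfl⟩
      exact hFs i (hs hi) (has i hi)

/-- The tight vertices of `P` lie in a proper face, are extreme there, and so are among the vertices
of a simplex, hence affinely independent. Applying `a` to a linear relation shows that its
coefficients sum to zero. -/
theorem linearIndependent_of_apply_eq_one {d : ℕ} (hS : IsSimplicialPolytope d P)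
    (hP : P = convexHull ℝ (φ '' I)) (hext : P.extremePoints ℝ = φ '' I) (hinj : Set.InjOn φ I)
    (hv : ∀ i, (v i : _) = φ i - p) (hsur : SurroundsOrigin I v) {a : vectorSpan ℝ P →L[ℝ] ℝ}
    (ha : ∀ i ∈ I, a (v i) ≤ 1) {s : Finset ι} (hs : s ⊆ I) (has : ∀ i ∈ s, a (v i) = 1) :
    LinearIndependent ℝ fun i : s => v i := by
  rcases s.eq_empty_or_nonempty with rfl | ⟨i₀, hi₀⟩
  · exact linearIndependent_empty_type
  obtain ⟨F, hF, hFs⟩ := exists_isProperFace hP hv hsur ha (hs hi₀) (has i₀ hi₀)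
  obtain ⟨t, ht, rfl⟩ := hS.2.2.2 F hF
  have hmem : ∀ i : s, φ i ∈ t := fun i => by
    have hFP : convexHull ℝ (t : Set (EuclideanSpace ℝ (Fin n))) ⊆ P :=
      (hF.1 : IsExposed ℝ P _).subset
    refine extremePoints_convexHull_subset (inter_extremePoints_subset_extremePoints_of_subset hFP
      ⟨hFs i (hs i.2) (has i i.2), ?_⟩)
    rw [hext]
    exact Set.mem_image_of_mem φ (hs i.2)
  have haff : AffineIndependent ℝ fun i : s => φ i :=
    ht.comp_embedding ⟨fun i : s => (⟨φ i, hmem i⟩ : t), fun i j hij =>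
      Subtype.ext (hinj (hs i.2) (hs j.2) (congrArg Subtype.val hij))⟩
  rw [Fintype.linearIndependent_iff]
  intro g hg
  have hsum : ∑ i, g i = 0 := by
    have h1 : ∑ i, g i * a (v i) = 0 := by simpa using congrArg a hg
    simpa [has] using h1
  refine fun i => affineIndependent_iff.mp haff Finset.univ g hsum ?_ i (Finset.mem_univ i)
  have h2 := congrArg (vectorSpan ℝ P).subtype hg
  simp only [map_sum, map_smul, Submodule.subtype_apply, hv, smul_sub, Finset.sum_sub_distrib,
    ← Finset.sum_smul, hsum, zero_smul, sub_zero] at h2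
  simpa using h2

/-- A vertex is strictly separated from the hull of the others; the separating functional, with its
sign reversed and scaled, is tight at that vertex. -/
theorem singleton_mem_polarComplex (hP : P = convexHull ℝ (φ '' I))
    (hext : P.extremePoints ℝ = φ '' I) (hinj : Set.InjOn φ I) (hv : ∀ i, (v i : _) = φ i - p)
    (hsur : SurroundsOrigin I v) (hdim : Module.finrank ℝ (vectorSpan ℝ P) ≠ 0) {i : ι}
    (hi : i ∈ I) : {i} ∈ polarComplex I v fun _ => 1 := by
  have hconv : Convex ℝ P := hP ▸ convex_convexHull ℝ _
  have hφi : φ i ∈ P.extremePoints ℝ := hext ▸ Set.mem_image_of_mem φ hi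
  have hnot := (hconv.mem_extremePoints_iff_mem_sdiff_convexHull_sdiff.mp hφi).2
  have hsub : φ '' (I \ {i}) ⊆ P \ {φ i} := by
    rintro _ ⟨j, ⟨hj, hji⟩, rfl⟩
    exact ⟨by rw [hP]; exact subset_convexHull ℝ _ (Set.mem_image_of_mem φ hj),
      fun e => hji (hinj hj hi e)⟩
  have hnot' : φ i ∉ convexHull ℝ (φ '' (I \ {i})) := fun h => hnot (convexHull_mono hsub h)
  have hfin : (φ '' ((I : Set ι) \ {i})).Finite := (I.finite_toSet.subset Set.sdiff_subset).image φ
  obtain ⟨l, u, hlu, hul⟩ := geometric_hahn_banach_point_closed (convex_convexHull ℝ _)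
    (hfin.isClosed_convexHull ℝ) hnot'
  set a := -(l.comp (vectorSpan ℝ P).subtypeL) with ha
  have hav : ∀ i, a (v i) = l p - l (φ i) := fun i => by
    rw [ha, neg_apply, ContinuousLinearMap.comp_apply,
      Submodule.subtypeL_apply, hv, map_sub, neg_sub]
  have hlt : ∀ j ∈ I, j ≠ i → a (v j) < a (v i) := fun j hj hji => by
    rw [hav, hav]
    have := hul (φ j) (subset_convexHull ℝ _ (Set.mem_image_of_mem φ ⟨hj, hji⟩))
    linarith
  have hle : ∀ j ∈ I, a (v j) ≤ a (v i) := fun j hj => by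
    rcases eq_or_ne j i with rfl | hji
    exacts [le_rfl, (hlt j hj hji).le]
  -- If `a = 0`, then `i` is the only index; in positive dimension a nonzero `b` and `-b` would both
  -- be positive at `v i`.
  have ha0 : a ≠ 0 := by
    intro ha0
    have honly : ∀ j ∈ I, j = i := fun j hj => by
      by_contra hji
      have := hlt j hj hji
      simp [ha0] at this
    have : Nontrivial (vectorSpan ℝ P) := Module.nontrivial_of_finrank_pos
      (Nat.pos_of_ne_zero hdim)
    obtain ⟨x, hx⟩ := exists_ne (0 : vectorSpan ℝ P)
    obtain ⟨b, -, hb⟩ := exists_dual_vector ℝ x (norm_ne_zero_iff.mpr hx)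
    have hb0 : b ≠ 0 := by
      rintro rfl
      exact hx (norm_eq_zero.mp (by simpa using hb.symm))
    have h1 := hsur.pos hb0 (m := b (v i)) fun j hj => by rw [honly j hj]
    have h2 := hsur.pos (neg_ne_zero.mpr hb0) (m := -b (v i)) fun j hj => by
      rw [honly j hj]; rfl
    linarith
  have hm := hsur.pos ha0 hle
  refine ⟨Finset.singleton_nonempty i, Finset.singleton_subset_iff.mpr hi, (a (v i))⁻¹ • a,
    fun j hj => ?_, fun j hj => ?_⟩
  · change (a (v i))⁻¹ * a (v j) ≤ 1
    rw [inv_mul_le_one₀ hm]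
    exact hle j hj
  · rw [Finset.mem_singleton.mp hj]
    exact inv_mul_cancel₀ hm.ne'

end Polytope

/-! ### High levels are small perturbations of the polar polytope -/

section Stability

variable {ι E : Type*} [NormedAddCommGroup E] [NormedSpace ℝ E] [FiniteDimensional ℝ E]
  {I : Finset ι} {v : ι → E}

omit [FiniteDimensional ℝ E] in
theorem mem_polarComplex_one_add_mul_iff {h : ι → ℝ} {x : ℝ} (hx : 0 < x) {s : Finset ι} :
    s ∈ polarComplex I v (fun i => 1 + x * h i) ↔ s ∈ sweep I v h x⁻¹ := by
  constructor
  · rintro ⟨hs, hsI, a, ha, has⟩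
    refine mem_sweep.mpr ⟨hs, hsI, x⁻¹ • a, fun i hi => ?_, fun i hi => ?_⟩
    · have := mul_le_mul_of_nonneg_left (ha i hi) (inv_pos.mpr hx).le
      calc x⁻¹ * a (v i) ≤ x⁻¹ * (1 + x * h i) := this
        _ = h i + x⁻¹ := by field_simp; ring
    · calc x⁻¹ * a (v i) = x⁻¹ * (1 + x * h i) := by rw [has i hi]
        _ = h i + x⁻¹ := by field_simp; ring
  · intro hmem
    obtain ⟨hs, hsI, a, ha, has⟩ := mem_sweep.mp hmem
    refine ⟨hs, hsI, x • a, fun i hi => ?_, fun i hi => ?_⟩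
    · calc x * a (v i) ≤ x * (h i + x⁻¹) := mul_le_mul_of_nonneg_left (ha i hi) hx.le
        _ = 1 + x * h i := by field_simp; ring
    · calc x * a (v i) = x * (h i + x⁻¹) := by rw [has i hi]
        _ = 1 + x * h i := by field_simp; ring

/-- A simplicial boundary complex is stable under small perturbations of the facets of the dual. -/
theorem eventually_mem_sweep_inv_iff (hsur : SurroundsOrigin I v)
    (hsimp : ∀ a : E →L[ℝ] ℝ, (∀ i ∈ I, a (v i) ≤ 1) → ∀ s ⊆ I, (∀ i ∈ s, a (v i) = 1) →
      LinearIndependent ℝ fun i : s => v i) (h : ι → ℝ) :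
    ∀ᶠ x in 𝓝[>] (0 : ℝ), ∀ s ⊆ I, s ∈ sweep I v h x⁻¹ ↔ s ∈ polarComplex I v fun _ => 1 := by
  classical
  have key : ∀ s ∈ I.powerset, ∀ᶠ x in 𝓝[>] (0 : ℝ),
      (s ∈ sweep I v h x⁻¹ ↔ s ∈ polarComplex I v fun _ => 1) := by
    intro s hs
    by_cases hmem : s ∈ polarComplex I v fun _ => 1
    · obtain ⟨hne, hsI, a, ha, has⟩ := id hmem
      -- Simpliciality lets one direction follow `h` on all tight inequalities at once, so faces
      -- survive.
      obtain ⟨w, hw⟩ := exists_apply_eq (hsimp a ha (I.filter fun i => a (v i) = 1)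
        (Finset.filter_subset _ _) fun i hi => (Finset.mem_filter.mp hi).2) h
      have hev := eventually_mem_polarComplex (g := h) hne hsI ha has
        (fun i hi => hw i (Finset.mem_filter.mpr ⟨hsI hi, has i hi⟩)) (l := 𝓝[>] 0)
        nhdsWithin_le_nhds fun i hi hai => by
          rw [hw i (Finset.mem_filter.mpr ⟨hi, hai⟩)]
          exact Eventually.of_forall fun _ => le_rfl
      filter_upwards [hev, self_mem_nhdsWithin] with x hx hx0
      exact iff_of_true ((mem_polarComplex_one_add_mul_iff hx0).mp hx) hmem
    · have hcl := isClosed_setOf_mem_polarComplex hsur (c := fun x i => 1 + x * h i)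
        (fun i => by fun_prop) s
      have hev : ∀ᶠ x in 𝓝 (0 : ℝ), x ∈ {x | s ∈ polarComplex I v fun i => 1 + x * h i}ᶜ :=
        hcl.isOpen_compl.mem_nhds (by simpa using hmem)
      filter_upwards [nhdsWithin_le_nhds hev, self_mem_nhdsWithin] with x hx hx0
      exact iff_of_false (fun h => hx ((mem_polarComplex_one_add_mul_iff hx0).mpr h)) hmem
  filter_upwards [(Filter.eventually_all_finset I.powerset).mpr key] with x hx s hs
  exact hx s (Finset.mem_powerset.mpr hs)

end Stability

end PreAbstractSimplicialComplex

namespace PreAbstractSimplicialComplex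

/-! ### From the polytope to the sweep -/

/-- Indices outside `I` are sent to `p`, so that with `p ∈ P` every `φ i - p` lies in the direction
space of `P`. -/
theorem exists_nat_parametrization {V : Type*} {X : Set V} (hX : X.Finite) (p : V) :
    ∃ (I : Finset ℕ) (φ : ℕ → V), Set.InjOn φ I ∧ φ '' I = X ∧ ∀ i, φ i ∈ insert p X := by
  obtain ⟨m, ⟨e⟩⟩ := hX.to_subtype.exists_equiv_fin
  refine ⟨Finset.range m, fun i => if h : i < m then e.symm ⟨i, h⟩ else p, ?_, ?_, ?_⟩
  · intro i hi j hj hij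
    have hi : i < m := by simpa using hi
    have hj : j < m := by simpa using hj
    simpa [hi, hj, Subtype.coe_inj] using hij
  · ext x
    constructor
    · rintro ⟨i, hi, rfl⟩
      have hi : i < m := by simpa using hi
      simp [hi]
    · intro hx
      exact ⟨e ⟨x, hx⟩, by simp, by simp⟩
  · intro i
    dsimp only
    split_ifs with h
    exacts [Or.inr (e.symm ⟨i, h⟩).2, Or.inl rfl]

theorem affineSpan_image_sub_eq_top {V : Type*} [NormedAddCommGroup V] [NormedSpace ℝ V]
    {ι : Type*} {P : Set V} {I : Finset ι} {φ : ι → V} {p : V} (hp : p ∈ P)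
    (hP : P = convexHull ℝ (φ '' I)) {q : ι → vectorSpan ℝ P} (hq : ∀ i, (q i : V) = φ i - p) :
    affineSpan ℝ (q '' I) = ⊤ := by
  have hne : (q '' I).Nonempty := by
    rw [hP] at hp
    exact ((convexHull_nonempty_iff.mp ⟨p, hp⟩).of_image).image q
  rw [AffineSubspace.affineSpan_eq_top_iff_vectorSpan_eq_top_of_nonempty ℝ _ _ hne]
  let f : vectorSpan ℝ P →ᵃ[ℝ] V :=
    (AffineEquiv.vaddConst ℝ p).toAffineMap.comp (vectorSpan ℝ P).subtype.toAffineMap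
  have hf : ∀ x, f x = (x : V) + p := fun x => rfl
  have himage : f '' (q '' I) = φ '' I := by
    rw [Set.image_image]
    exact Set.image_congr fun i _ => by rw [hf, hq, sub_add_cancel]
  have h1 := f.map_vectorSpan (s := q '' I)
  have h2 : vectorSpan ℝ (φ '' I) = vectorSpan ℝ P := by
    conv_rhs => rw [← direction_affineSpan, hP, affineSpan_convexHull, direction_affineSpan]
  have h3 : f.linear = (vectorSpan ℝ P).subtype := by
    ext x; simp [f]
  rw [himage, h2, h3] at h1
  refine Submodule.map_injective_of_injective (vectorSpan ℝ P).subtype_injective ?_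
  rw [h1, Submodule.map_subtype_top]

theorem isStellated_of_isNeighbourly {V : Type*} {d k : ℕ} {S : PreAbstractSimplicialComplex V}
    (hS : S.IsPolytopalSphere d) (hk : k ≤ d) (hnb : S.IsNeighbourly (k + 1)) :
    S.IsStellated d (d - k) := by
  classical
  obtain ⟨n, P, hP, hiso⟩ := hS
  obtain ⟨⟨t, ht⟩, ⟨p₀, hp₀⟩, hdim, -⟩ := id hP
  have hXfin : (P.extremePoints ℝ).Finite :=
    t.finite_toSet.subset (ht ▸ extremePoints_convexHull_subset)
  have hPX : convexHull ℝ (P.extremePoints ℝ) = P := by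
    have hcompact : IsCompact P := ht ▸ t.finite_toSet.isCompact_convexHull ℝ
    have hconv : Convex ℝ P := ht ▸ convex_convexHull ℝ _
    rw [← (hXfin.isClosed_convexHull ℝ).closure_eq, closure_convexHull_extremePoints hcompact hconv]
  obtain ⟨I, φ, hinj, him, hφ⟩ := exists_nat_parametrization hXfin p₀
  have hφP : ∀ i, φ i ∈ P := fun i => by
    rcases hφ i with h | h
    exacts [h ▸ hp₀, h.1]
  rw [← him] at hPX
  have hspan := affineSpan_image_sub_eq_top (q := fun i => ⟨φ i - p₀,
    vsub_mem_vectorSpan ℝ (hφP i) hp₀⟩) hp₀ hPX.symm fun i => rfl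
  obtain ⟨x, hsur, hgen⟩ := exists_surroundsOrigin_sub hspan
  set v : ℕ → vectorSpan ℝ P := fun i => ⟨φ i - p₀, vsub_mem_vectorSpan ℝ (hφP i) hp₀⟩ - x with hvdef
  have hv : ∀ i, (v i : EuclideanSpace ℝ (Fin n)) = φ i - (p₀ + x) := fun i => by
    simp [hvdef, sub_sub]
  obtain ⟨h, H⟩ := exists_isGenericSweep hsur hgen
  have hstable := eventually_mem_sweep_inv_iff hsur (fun a ha s hs has =>
    linearIndependent_of_apply_eq_one hP hPX.symm him.symm hinj hv hsur ha hs has) h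
  -- Only finitely many levels are critical, and `y⁻¹` tends to infinity.
  have hregular : ∀ᶠ y in 𝓝[>] (0 : ℝ), ∀ T, ¬ IsCriticalAt I v h y⁻¹ T := by
    obtain ⟨M, hM⟩ := H.finite_criticalLevels.bddAbove
    filter_upwards [tendsto_inv_nhdsGT_zero.eventually_gt_atTop M] with y hy T hT
    exact (hM ⟨T, hT⟩).not_gt hy
  obtain ⟨y, hy, hyreg⟩ := (hstable.and hregular).exists
  have hvertex : ∀ i ∈ I, {i} ∈ sweep I v h y⁻¹ := fun i hi =>
    (hy _ (Finset.singleton_subset_iff.mpr hi)).mpr (singleton_mem_polarComplex hPX.symm him.symm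
      hinj hv hsur (by rw [hdim]; omega) hi)
  have hvertices : (sweep I v h y⁻¹).vertices = I := Set.ext fun i =>
    ⟨fun hi => Finset.singleton_subset_iff.mp (mem_sweep.mp hi).2.1, fun hi => hvertex i hi⟩
  have hface : ∀ s ⊆ I, s.image φ ∈ polytopeBoundaryComplex P ↔ s ∈ sweep I v h y⁻¹ :=
    fun s hs => (image_mem_polytopeBoundaryComplex_iff hPX.symm him.symm hv hsur hs).trans
      (hy s hs).symm
  have hiso' : S.IsIsomorphic (sweep I v h y⁻¹) := by
    refine hiso.trans (isIsomorphic_of_image φ (hvertices ▸ hinj) ?_ fun s hs =>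
      hface s (Finset.coe_subset.mp (hvertices ▸ hs)))
    rw [hvertices]
    refine Set.Subset.antisymm ?_ fun z hz => ?_
    · rintro _ ⟨i, hi, rfl⟩
      have := (hface {i} (Finset.singleton_subset_iff.mpr hi)).mpr (hvertex i hi)
      rwa [Finset.image_singleton] at this
    · rw [him]
      exact hz.2.1 (by simp)
  have hIne : I.Nonempty := by
    rw [← hPX] at hp₀
    exact Finset.coe_nonempty.mp (convexHull_nonempty_iff.mp ⟨p₀, hp₀⟩).of_image
  have hnbI : ∀ s ⊆ I, s.Nonempty → s.card ≤ k + 1 → s ∈ sweep I v h y⁻¹ := by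
    intro s hs hne hcard
    -- Dimension `d + 1` forces at least `d + 2` vertices, so a smaller set extends to `k + 1`
    -- vertices, where neighbourliness applies.
    have hIcard : k + 1 ≤ I.card := by
      obtain ⟨m, hm⟩ := Nat.exists_eq_succ_of_ne_zero (Finset.card_pos.mpr hIne).ne'
      have h1 := finrank_vectorSpan_image_finset_le ℝ φ I hm
      rw [Finset.coe_image, ← direction_affineSpan, ← affineSpan_convexHull, hPX,
        direction_affineSpan, hdim] at h1
      omega
    obtain ⟨u, hsu, huI, hu⟩ := Finset.exists_subsuperset_card_eq hs hcard hIcard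
    rcases hnb.of_isIsomorphic hiso' u (by rw [hvertices]; exact Finset.coe_subset.mpr huI) hu with
      rfl | hmem
    · simp at hu
    · exact ((sweep I v h y⁻¹).isRelLowerSet_faces hmem).2 hsu hne
  obtain ⟨α, hα, hmoves⟩ := H.reflTransGen_simplexBoundary_sweep hdim hk hyreg hnbI
    (hIne.elim fun i hi => ⟨{i}, hvertex i hi⟩)
  exact ⟨α, _, hα, hmoves, hiso'⟩

end PreAbstractSimplicialComplex

theorem theorem5 {V : Type*} (d : ℕ) (S : PreAbstractSimplicialComplex V)
    (hS : S.IsPolytopalSphere d) :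
    (∀ k : ℕ, k ≤ d → S.IsNeighbourly (k + 1) → S.IsStellated d (d - k)) ∧
      S.IsStellated d d := by
  refine ⟨fun k hk hnb => PreAbstractSimplicialComplex.isStellated_of_isNeighbourly hS hk hnb,
    -- Every complex is `1`-neighbourly, since its vertices are faces.
    PreAbstractSimplicialComplex.isStellated_of_isNeighbourly (k := 0) hS (Nat.zero_le d) fun s hs hcard => ?_⟩
  obtain ⟨x, rfl⟩ := Finset.card_eq_one.mp hcard
  exact Or.inr (hs (by simp))
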